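/- **Setting.** Let $\Sigma$ be a signature, $\mathcal V$ a set of variables, $\mathcal T$ the set of terms over $\Sigma$ and $\mathcal V$, and let $\mathcal D\subseteq\Sigma$ be a set of *defined symbols*. For each $f\in\mathcal D$ let $f^\#$ be a fresh *annotated* symbol of the same arity, $\mathcal D^\#=\{f^\#\mid f\in\mathcal D\}$, $\Sigma^\#=\Sigma\uplus\mathcal D^\#$, and let $\mathcal T^\#$ be the set of terms over $\Sigma^\#$ and $\mathcal V$. Substitutions $\sigma:\mathcal V\to\mathcal T$ move only finitely many variables. $\mathrm{Pos}_{\mathcal X}(t)$ denotes the set of positions of $t$ with symbols or variables from $\mathcal X$; $\flat(t)$ removes all annotations from $t$; $\#_\Phi(t)$ is the variant of $t$ in which exactly the symbols at positions in $\Phi$ are annotated; $\flat^\uparrow_\pi(t)$ removes all annotations of $t$ strictly above position $\pi$; and $t^\#=\#_{\{\varepsilon\}}(t)$ annotates the root. An *annotated dependency pair* (ADP) is $\ell\to\{p_1:r_1,\dots,p_k:r_k\}^m$ with $\ell\in\mathcal T$ whose root is in $\mathcal D$ (so $\ell\notin\mathcal V$), a flag $m\in\{\mathsf{true},\mathsf{false}\}$,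 and a finite multiset of pairs with $r_j\in\mathcal T^\#$, $\mathcal V(r_j)\subseteq\mathcal V(\ell)$, $0<p_j\le1$, $\sum_jp_j=1$. An *ADP problem* is a finite set $\mathcal P$ of ADPs, and $\flat(\mathcal P)$ results from $\mathcal P$ by removing all annotations (keeping the flags). A *variable reposition function* family for an ADP consists of functions $\varphi_j:\mathrm{Pos}_{\mathcal V}(\ell)\to\mathrm{Pos}_{\mathcal V}(r_j)\uplus\{\bot\}$ with $\ell|_\rho=r_j|_{\varphi_j(\rho)}$ whenever $\varphi_j(\rho)\ne\bot$. A term $s\in\mathcal T^\#$ *rewrites* with $\mathcal P$ to $\{p_1:t_1,\dots,p_k:t_k\}$ if there are an ADP $\ell\to\{p_1:r_1,\dots,p_k:r_k\}^m\in\mathcal P$, a variable reposition function family $(\varphi_j)_j$ for it, a substitution $\sigma$ and a $\pi\in\mathrm{Pos}_{\mathcal D\cup\mathcal D^\#}(s)$ with $\flat(s|_\pi)=\ell\sigma$ such that, with $\Psi_j=\{\varphi_j(\rho).\tau\mid\rho\in\mathrm{Pos}_{\mathcal V}(\ell),\ \varphi_j(\rho)\ne\bot,\ \rho.\tau\in\mathrm{Pos}_{\mathcal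 D^\#}(s|_\pi)\}$ and $\Phi_j=\mathrm{Pos}_{\mathcal D^\#}(r_j)\cup\Psi_j$, for all $j$: - (at) $t_j=s[\#_{\Phi_j}(r_j\sigma)]_\pi$ if $\pi\in\mathrm{Pos}_{\mathcal D^\#}(s)$ and $m=\mathsf{true}$; - (af) $t_j=\flat^\uparrow_\pi(s[\#_{\Phi_j}(r_j\sigma)]_\pi)$ if $\pi\in\mathrm{Pos}_{\mathcal D^\#}(s)$ and $m=\mathsf{false}$; - (nt) $t_j=s[\#_{\Psi_j}(r_j\sigma)]_\pi$ if $\pi\notin\mathrm{Pos}_{\mathcal D^\#}(s)$ and $m=\mathsf{true}$; - (nf) $t_j=\flat^\uparrow_\pi(s[\#_{\Psi_j}(r_j\sigma)]_\pi)$ if $\pi\notin\mathrm{Pos}_{\mathcal D^\#}(s)$ and $m=\mathsf{false}$. A *$\mathcal P$-chain tree* is a (possibly infinite) finitely branching directed tree whose nodes $v$ are labeled by a probability $p_v\in(0,1]$ (with $p_v=1$ at the root) and a term $t_v\in\mathcal T^\#$, together with a set $A$ of inner nodes, such that for every inner node $v$ with successors $w_1,\dots,w_k$ the term $t_v$ rewrites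 with $\mathcal P$ to $\{\frac{p_{w_1}}{p_v}:t_{w_1},\dots,\frac{p_{w_k}}{p_v}:t_{w_k}\}$, using (at) or (af) if $v\in A$ and (nt) or (nf) if $v\notin A$, and such that every infinite path contains infinitely many nodes of $A$. $\mathcal P$ is *almost-surely terminating* ($\mathtt{AST}$) if $\sum_{v\text{ leaf}}p_v=1$ for every $\mathcal P$-chain tree. Let $\mathrm{np}(\mathcal P)$ be the term rewrite system of all rules $\ell\to\flat(r_j)$ with $\ell\to\{p_1:r_1,\dots,p_k:r_k\}^{\mathsf{true}}\in\mathcal P$ and $1\le j\le k$. The *$\mathcal P$-dependency graph* has the nodes $\mathcal P$ and an edge from $\ell_1\to\{p_1:r_1,\dots,p_k:r_k\}^m$ to $\ell_2\to\cdots$ if there are substitutions $\sigma_1,\sigma_2$, some $j$, and some $\tau\in\mathrm{Pos}_{\mathcal D^\#}(r_j)$ such that $t=\flat(r_j|_\tau)$ satisfies $t^\#\sigma_1\to^*_{\mathrm{np}(\mathcal P)}\ell_2^\#\sigma_2$. An *SCC* is a maximal non-empty set $\mathcal P'\subseteq\mathcal P$ such that for all $\alpha,\alpha'\in\mathcal P'$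 there is a non-empty path from $\alpha$ to $\alpha'$ traversing only nodes of $\mathcal P'$. **Theorem (Dependency Graph Processor for $\mathtt{AST}$).** The processor that maps each ADP problem $\mathcal P$, with $\mathcal P_1,\dots,\mathcal P_n$ the SCCs of its dependency graph, to $$\mathrm{Proc}_{\mathtt{DG}}(\mathcal P)=\{\mathcal P_1\cup\flat(\mathcal P\setminus\mathcal P_1),\ \dots,\ \mathcal P_n\cup\flat(\mathcal P\setminus\mathcal P_n)\}$$ is sound and complete for $\mathtt{AST}$. That is, for every ADP problem $\mathcal P$: if all problems in $\mathrm{Proc}_{\mathtt{DG}}(\mathcal P)$ are $\mathtt{AST}$ then $\mathcal P$ is $\mathtt{AST}$ (soundness), and if $\mathcal P$ is $\mathtt{AST}$ then all problems in $\mathrm{Proc}_{\mathtt{DG}}(\mathcal P)$ are $\mathtt{AST}$ (completeness). -/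

import Mathlib

open FirstOrder

namespace ProbADP

/-! ### Terms, positions, substitutions, term rewriting

A signature is (the function symbols of) a first-order language, terms are Mathlib's terms.
Positions are lists of argument indices (counted from `0`). -/

section Terms

variable {L : Language} {V : Type*}

/-- The subterm `t|_π`; `none` if `π` is not a position of `t`. -/
def subtermAt : L.Term V → List ℕ → Option (L.Term V)
  | t, [] => some t
  | .var _, _ :: _ => none
  | .func (l := l) _ ts, i :: π => if h : i < l then subtermAt (ts ⟨i, h⟩) π else none

/-- The term `t[s]_π` (equal to `t` if `π` is not a position of `t`). -/
def replaceAt : L.Term V → List ℕ → L.Term V → L.Term V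
  | _, [], s => s
  | .var x, _ :: _, _ => .var x
  | .func f ts, i :: π, s =>
      .func f (fun j => if (j : ℕ) = i then replaceAt (ts j) π s else ts j)

/-- The positions of `t` at which a variable occurs. -/
def varPos (t : L.Term V) : Set (List ℕ) :=
  {π | ∃ x, subtermAt t π = some (.var x)}

/-- The set of variables of `t`. -/
def vars (t : L.Term V) : Set V :=
  {x | ∃ π, subtermAt t π = some (.var x)}

/-- Substitutions move only finitely many variables. -/
def IsSubst (σ : V → L.Term V) : Prop :=
  {x | σ x ≠ .var x}.Finite

/-- One rewrite step `s →_R t` of a term rewrite system `R`. -/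
def Rewrites (R : Set (L.Term V × L.Term V)) (s t : L.Term V) : Prop :=
  ∃ rule ∈ R, ∃ σ : V → L.Term V, IsSubst σ ∧ ∃ π : List ℕ,
    subtermAt s π = some (rule.1.subst σ) ∧ t = replaceAt s π (rule.2.subst σ)

end Terms

/-! ### Annotated terms -/

/-- The signature `Σ^# = Σ ⊎ D^#`: every symbol `f` of `D` gets an annotated copy `f^#`
of the same arity. -/
def annotatedSig (L : Language) (D : ∀ n, Set (L.Functions n)) : Language where
  Functions n := L.Functions n ⊕ D n
  Relations _ := Empty

/-- Annotated terms: terms over `Σ^#`. -/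
abbrev ATerm (L : Language) (D : ∀ n, Set (L.Functions n)) (V : Type*) :=
  (annotatedSig L D).Term V

section Annotations

variable {L : Language} {D : ∀ n, Set (L.Functions n)} {V : Type*}

/-- A symbol of `Σ`, as a symbol of `Σ^#`. -/
def plainSym {n : ℕ} (f : L.Functions n) : (annotatedSig L D).Functions n := Sum.inl f

/-- The annotated symbol `f^#` for `f` in `D`. -/
def sharpSym {n : ℕ} (f : D n) : (annotatedSig L D).Functions n := Sum.inr f

/-- The symbol of `Σ` underlying a symbol of `Σ^#`. -/
def unsharp {n : ℕ} : (annotatedSig L D).Functions n → L.Functions n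
  | .inl f => f
  | .inr f => f.1

/-- `♭(t)`: remove all annotations. -/
def flat : ATerm L D V → L.Term V
  | .var x => .var x
  | .func f ts => .func (unsharp f) (fun i => flat (ts i))

/-- The positions of annotated symbols (symbols of `D^#`). -/
def annPos (t : ATerm L D V) : Set (List ℕ) :=
  {π | ∃ (n : ℕ) (f : D n) (ts : Fin n → ATerm L D V),
    subtermAt t π = some (.func (sharpSym f) ts)}

/-- The positions of symbols of `D ∪ D^#`. -/
def definedPos (t : ATerm L D V) : Set (List ℕ) :=
  {π | ∃ (n : ℕ) (f : (annotatedSig L D).Functions n) (ts : Fin n → ATerm L D V),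
    unsharp f ∈ D n ∧ subtermAt t π = some (.func f ts)}

open Classical in
/-- `anno t Φ`: annotate exactly the symbols of `D` at the positions in `Φ`. -/
noncomputable def anno : L.Term V → Set (List ℕ) → ATerm L D V
  | .var x, _ => .var x
  | .func (l := n) f ts, Φ =>
      .func (if h : [] ∈ Φ ∧ f ∈ D n then sharpSym ⟨f, h.2⟩ else plainSym f)
        (fun i => anno (ts i) {π | (i : ℕ) :: π ∈ Φ})

/-- A term over `Σ`, regarded as a term over `Σ^#` without annotations. -/
noncomputable def embed (t : L.Term V) : ATerm L D V := anno t ∅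

/-- `t^#`: annotate the root of `t` (for terms whose root is in `D`). -/
noncomputable def sharp (t : L.Term V) : ATerm L D V := anno t {[]}

/-- Remove all annotations strictly above the position `π`. -/
def disannoAbove : ATerm L D V → List ℕ → ATerm L D V
  | t, [] => t
  | .var x, _ :: _ => .var x
  | .func f ts, i :: π =>
      .func (plainSym (unsharp f))
        (fun j => if (j : ℕ) = i then disannoAbove (ts j) π else ts j)

end Annotations

/-! ### Annotated dependency pairs -/

/-- A finite multi-distribution: a finite multiset of pairs `(p : a)` with `0 < p ≤ 1` whose
probabilities sum up to `1`. -/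
def IsMultiDist {A : Type*} (μ : Multiset (ℝ × A)) : Prop :=
  (∀ x ∈ μ, 0 < x.1 ∧ x.1 ≤ 1) ∧ (μ.map Prod.fst).sum = 1

/-- An annotated dependency pair `ℓ → {p₁ : r₁, …, p_k : r_k}^m`. The left-hand side is not a
variable and its root is a defined symbol. -/
@[ext]
structure ADP (L : Language) (D : ∀ n, Set (L.Functions n)) (V : Type*) where
  lhs : L.Term V
  rhs : Multiset (ℝ × ATerm L D V)
  flag : Bool
  lhs_root : ∃ (n : ℕ) (f : L.Functions n) (ts : Fin n → L.Term V), f ∈ D n ∧ lhs = .func f ts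
  rhs_dist : IsMultiDist rhs
  rhs_vars : ∀ x ∈ rhs, vars x.2 ⊆ vars lhs

noncomputable instance {L : Language} {D : ∀ n, Set (L.Functions n)} {V : Type*} :
    DecidableEq (ADP L D V) := Classical.decEq _

/-- An ADP problem is a finite set of ADPs. -/
abbrev ADPProblem (L : Language) (D : ∀ n, Set (L.Functions n)) (V : Type*) :=
  Finset (ADP L D V)

section Lemmas

variable {L : Language} {D : ∀ n, Set (L.Functions n)} {V : Type*}

theorem subtermAt_embed_flat (t : ATerm L D V) (π : List ℕ) :
    subtermAt (embed (D := D) (flat t)) π =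
      (subtermAt t π).map (fun u => embed (D := D) (flat u)) := by
  induction t generalizing π with
  | var x => cases π <;> simp [flat, embed, anno, subtermAt]
  | @func n f ts ih =>
    cases π with
    | nil => simp [subtermAt]
    | cons i π =>
      by_cases h : i < n
      · have := ih ⟨i, h⟩ π
        simp only [embed] at this
        simp only [flat, embed, anno, subtermAt, h, dite_true]
        exact this
      · simp [flat, embed, anno, subtermAt, h]

theorem vars_embed_flat (t : ATerm L D V) : vars (embed (D := D) (flat t)) = vars t := by
  ext x
  simp only [vars, Set.mem_ofPred_eq, subtermAt_embed_flat]
  refine exists_congr fun π => ?_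
  constructor
  · intro h
    obtain ⟨u, hu, h'⟩ := Option.map_eq_some_iff.1 h
    cases u with
    | var y => simpa [flat, embed, anno] using hu.trans (congrArg some h')
    | func f ts => simp [flat, embed, anno] at h'
  · intro h
    simp [h, flat, embed, anno]

end Lemmas

section Framework

variable {L : Language} {D : ∀ n, Set (L.Functions n)} {V : Type*}

/-- Remove all annotations from the right-hand sides of an ADP. -/
noncomputable def ADP.flat (α : ADP L D V) : ADP L D V where
  lhs := α.lhs
  rhs := α.rhs.map (fun x => (x.1, embed (ProbADP.flat x.2)))
  flag := α.flag
  lhs_root := α.lhs_root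
  rhs_dist := by
    obtain ⟨h1, h2⟩ := α.rhs_dist
    refine ⟨fun x hx => ?_, ?_⟩
    · obtain ⟨y, hy, rfl⟩ := Multiset.mem_map.1 hx
      exact h1 y hy
    · rw [Multiset.map_map]
      exact h2
  rhs_vars := by
    intro x hx
    obtain ⟨y, hy, rfl⟩ := Multiset.mem_map.1 hx
    rw [vars_embed_flat]
    exact α.rhs_vars y hy

/-- `♭(P)`. -/
noncomputable def flatProblem (P : ADPProblem L D V) : ADPProblem L D V := P.image ADP.flat

/-! ### Rewriting with ADPs -/

/-- `φ` is a variable reposition function from (the variable positions of) `ℓ` to (those of)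
`r`; the value `none` stands for `⊥`. Values of `φ` outside `varPos ℓ` are never used. -/
def IsVRF (ℓ : L.Term V) (r : ATerm L D V) (φ : List ℕ → Option (List ℕ)) : Prop :=
  ∀ ρ ∈ varPos ℓ, ∀ ρ', φ ρ = some ρ' →
    ∃ x, subtermAt ℓ ρ = some (.var x) ∧ subtermAt r ρ' = some (.var x)

/-- The set `Ψ` of positions of annotations that are kept when an instance `u` of `ℓ` is
rewritten using the variable reposition function `φ`. -/
def keptPos (ℓ : L.Term V) (u : ATerm L D V) (φ : List ℕ → Option (List ℕ)) : Set (List ℕ) :=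
  {χ | ∃ ρ ∈ varPos ℓ, ∃ ρ' τ, φ ρ = some ρ' ∧ ρ ++ τ ∈ annPos u ∧ χ = ρ' ++ τ}

/-- `Step P a s μ`: the annotated term `s` rewrites with `P` to the multi-distribution `μ`,
where the proposition `a` says whether the redex is annotated. With the flag `m` of the ADP the
four cases are (at): `a` and `m = true`, (af): `a` and `m = false`, (nt): not `a` and `m = true`,
(nf): not `a` and `m = false`. -/
def Step (P : ADPProblem L D V) (a : Prop) (s : ATerm L D V)
    (μ : Multiset (ℝ × ATerm L D V)) : Prop :=
  ∃ α ∈ P, ∃ (k : ℕ) (p : Fin k → ℝ) (r : Fin k → ATerm L D V),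
    α.rhs = Finset.univ.val.map (fun j => (p j, r j)) ∧
    ∃ φ : Fin k → List ℕ → Option (List ℕ), (∀ j, IsVRF α.lhs (r j) (φ j)) ∧
    ∃ σ : V → L.Term V, IsSubst σ ∧
    ∃ π ∈ definedPos s, ∃ u, subtermAt s π = some u ∧ flat u = α.lhs.subst σ ∧
    (a ↔ π ∈ annPos s) ∧
    ∃ t : Fin k → ATerm L D V,
      (∀ j, t j = replaceAt s π (anno ((flat (r j)).subst σ)
        ({τ | a ∧ τ ∈ annPos (r j)} ∪ keptPos α.lhs u (φ j)))) ∧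
      μ = Finset.univ.val.map
        (fun j => (p j, if α.flag = true then t j else disannoAbove (t j) π))

/-! ### Chain trees and almost-sure termination -/

/-- A `P`-chain tree. The directed tree is given by its root and the finite sets of children.
(Such a tree is countable, so that nodes in `Type` suffice.) -/
structure ChainTree (P : ADPProblem L D V) where
  Node : Type
  root : Node
  children : Node → Finset Node
  root_not_child : ∀ v, root ∉ children v
  parent_unique : ∀ v v' w, w ∈ children v → w ∈ children v' → v = v'
  reachable : ∀ v, Relation.ReflTransGen (fun x y => y ∈ children x) root v
  prob : Node → ℝ
  term : Node → ATerm L D V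
  prob_pos : ∀ v, 0 < prob v
  prob_le_one : ∀ v, prob v ≤ 1
  prob_root : prob root = 1
  /-- The inner nodes where an annotated redex is rewritten. -/
  A : Set Node
  inner_of_mem_A : ∀ v ∈ A, (children v).Nonempty
  step : ∀ v, (children v).Nonempty →
    Step P (v ∈ A) (term v) ((children v).val.map (fun w => (prob w / prob v, term w)))
  infinite_path : ∀ x : ℕ → Node, (∀ n, x (n + 1) ∈ children (x n)) → {n | x n ∈ A}.Infinite

/-- `|T|_Leaf`: the sum of the probabilities of all leaves. -/
noncomputable def ChainTree.leafMass {P : ADPProblem L D V} (T : ChainTree P) : ENNReal :=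
  ∑' v : {v : T.Node // T.children v = ∅}, ENNReal.ofReal (T.prob v)

/-- `P` is almost-surely terminating. -/
def IsAST (P : ADPProblem L D V) : Prop := ∀ T : ChainTree P, T.leafMass = 1

/-! ### Dependency graph and processors -/

/-- The non-probabilistic variant `np(P)`, an ordinary TRS over `Σ`. -/
def np (P : ADPProblem L D V) : Set (L.Term V × L.Term V) :=
  {rule | ∃ α ∈ P, α.flag = true ∧ ∃ x ∈ α.rhs, rule = (α.lhs, flat x.2)}

/-- Rewriting of annotated terms with the rules of `np(P)`. -/
def npRewrites (P : ADPProblem L D V) : ATerm L D V → ATerm L D V → Prop :=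
  Rewrites ((fun rule : L.Term V × L.Term V => (embed rule.1, embed rule.2)) '' np P)

/-- `t ⊴_# s`: `t` results from a subterm of `s` with annotated root by removing all
annotations. -/
def AnnSubterm (t : L.Term V) (s : ATerm L D V) : Prop :=
  ∃ π ∈ annPos s, ∃ u, subtermAt s π = some u ∧ t = flat u

/-- The edges of the `P`-dependency graph (its nodes are the elements of `P`). As `t` and the
left-hand sides are not variables, `t^# σ = (t σ)^#`. -/
def Edge (P : ADPProblem L D V) (α β : ADP L D V) : Prop :=
  ∃ σ₁ σ₂ : V → L.Term V, IsSubst σ₁ ∧ IsSubst σ₂ ∧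
    ∃ x ∈ α.rhs, ∃ t, AnnSubterm t x.2 ∧
      Relation.ReflTransGen (npRewrites P) (sharp (t.subst σ₁)) (sharp (β.lhs.subst σ₂))

/-- `X` is a cycle: a non-empty set of nodes such that any two of them (possibly equal) are
connected by a non-empty path that only traverses nodes of `X`. -/
def IsCycle (P X : ADPProblem L D V) : Prop :=
  X ⊆ P ∧ X.Nonempty ∧ ∀ α ∈ X, ∀ β ∈ X,
    Relation.TransGen (fun γ δ => γ ∈ X ∧ δ ∈ X ∧ Edge P γ δ) α β

/-- The strongly connected components of the dependency graph: the maximal cycles. -/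
def IsSCC (P X : ADPProblem L D V) : Prop := Maximal (IsCycle P) X

/-- An ADP processor maps an ADP problem to a finite set of ADP problems. -/
abbrev Processor (L : Language) (D : ∀ n, Set (L.Functions n)) (V : Type*) :=
  ADPProblem L D V → Finset (ADPProblem L D V)

/-- Soundness of a processor for almost-sure termination. -/
def Processor.Sound (proc : Processor L D V) : Prop :=
  ∀ P, (∀ Q ∈ proc P, IsAST Q) → IsAST P

/-- Completeness of a processor for almost-sure termination. -/
def Processor.Complete (proc : Processor L D V) : Prop :=
  ∀ P, IsAST P → ∀ Q ∈ proc P, IsAST Q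

open Classical in
/-- The dependency graph processor `P ↦ {X ∪ ♭(P \ X) | X an SCC of the P-dependency graph}`. -/
noncomputable def depGraphProcessor (L : Language) (D : ∀ n, Set (L.Functions n)) (V : Type*) :
    Processor L D V :=
  fun P => (P.powerset.filter (IsSCC P)).image (fun X => X ∪ flatProblem (P \ X))

end Framework

end ProbADP

/-!
The dependency graph processor is sound because infinite behaviour of a chain tree can be located
in a single SCC with positive probability, and complete because it only removes annotations.

Both directions relabel the terms of a chain tree: the same redexes are contracted with ADPs that
differ in the annotations of their right-hand sides, and the new annotations are propagated along
the tree (`ChainTree.exists_relabel`). For completeness, a tree for `X ∪ ♭(P \ X)` is relabelled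
with the ADPs of `P`. Its annotations can only grow, so the result is a `P`-chain tree with the
same leaves (`IsAST.of_refines`).

For soundness, consider a `P`-chain tree whose leaves do not have total probability `1`. On every
infinite path, annotations form lineages: an annotation is kept by a step, or it is used as the
redex and gives rise to the annotations of the right-hand side. As a kept annotation is never
duplicated and as infinitely many annotations are used, a König argument yields a lineage that is
used infinitely often (`exists_lineage`). The ADPs that use it form an infinite path of the
dependency graph (`edge_of_lineage`), which eventually stays in one SCC `X`
(`exists_lineage_in_scc`). So if the tree is relabelled with the ADPs of `X ∪ ♭(P \ X)`, starting
with all annotations at a sufficiently late node `v` of the path, then the lineage remains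
annotated and the path has infinitely many annotated steps.

There are only countably many pairs `(v, X)`, so for one of them the paths below `v` with
infinitely many annotated steps after relabelling have positive probability. Probabilities are
measured by realizing nodes as nested intervals whose lengths are the probabilities of the
nodes. By continuity of the measure there are depths `d₀ < d₁ < …` such that, up to a set
of small measure, these paths have an annotated step in every window `[d_j, d_{j+1})`. Cutting the
tree at the nodes of depth `d_{j+1}` without an annotated step in the preceding window leaves a
chain tree for `X ∪ ♭(P \ X)` in which infinite paths still have positive probability
(`ProbTree.exists_cut`, `not_isAST_of_cut`).
-/

namespace ProbADP

/-! ### Positions of terms -/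

section Terms

variable {L : Language} {V : Type*}

@[simp] theorem subtermAt_nil (t : L.Term V) : subtermAt t [] = some t := by
  cases t <;> rfl

@[simp] theorem subtermAt_var_cons (x : V) (i : ℕ) (π : List ℕ) :
    subtermAt (.var x : L.Term V) (i :: π) = none := rfl

theorem subtermAt_func_cons {n : ℕ} (f : L.Functions n) (ts : Fin n → L.Term V) (i : ℕ)
    (π : List ℕ) :
    subtermAt (.func f ts) (i :: π) = if h : i < n then subtermAt (ts ⟨i, h⟩) π else none := rfl

@[simp] theorem replaceAt_nil (t s : L.Term V) : replaceAt t [] s = s := by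
  cases t <;> rfl

theorem replaceAt_func_cons {n : ℕ} (f : L.Functions n) (ts : Fin n → L.Term V) (i : ℕ)
    (π : List ℕ) (s : L.Term V) :
    replaceAt (.func f ts) (i :: π) s =
      .func f (fun j => if (j : ℕ) = i then replaceAt (ts j) π s else ts j) := rfl

theorem subtermAt_append (t : L.Term V) (π τ : List ℕ) :
    subtermAt t (π ++ τ) = (subtermAt t π).bind (fun u => subtermAt u τ) := by
  induction π generalizing t with
  | nil => simp
  | cons i π ih =>
    cases t with
    | var x => simp
    | @func n f ts =>
      simp only [List.cons_append, subtermAt_func_cons]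
      split_ifs with h
      · exact ih _
      · rfl

theorem subtermAt_append_of_eq_some {t u : L.Term V} {π : List ℕ} (h : subtermAt t π = some u)
    (τ : List ℕ) : subtermAt t (π ++ τ) = subtermAt u τ := by
  rw [subtermAt_append, h, Option.bind_some]

theorem subtermAt_replaceAt_append {t u : L.Term V} {π : List ℕ} (h : subtermAt t π = some u)
    (s : L.Term V) (τ : List ℕ) : subtermAt (replaceAt t π s) (π ++ τ) = subtermAt s τ := by
  induction π generalizing t with
  | nil => simp
  | cons i π ih =>
    cases t with
    | var x => simp at h
    | @func n f ts =>
      rw [subtermAt_func_cons] at h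
      split_ifs at h with hi
      simp only [replaceAt_func_cons, List.cons_append, subtermAt_func_cons, hi, dite_true,
        if_true]
      exact ih h

/-- Positions that are neither above nor below `π` are not affected by a replacement at `π`. -/
theorem subtermAt_replaceAt_of_incomparable (t s : L.Term V) {π χ : List ℕ}
    (h₁ : ¬ π <+: χ) (h₂ : ¬ χ <+: π) : subtermAt (replaceAt t π s) χ = subtermAt t χ := by
  induction π generalizing t χ with
  | nil => simp at h₁
  | cons i π ih =>
    cases χ with
    | nil => simp at h₂
    | cons j χ =>
      cases t with
      | var x => rfl
      | @func n f ts =>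
        simp only [replaceAt_func_cons, subtermAt_func_cons]
        split_ifs with hj hji
        · subst hji
          exact ih _ (by simpa using h₁) (by simpa using h₂)
        · rfl
        · rfl

theorem subtermAt_replaceAt_above {t v : L.Term V} {χ : List ℕ} (h : subtermAt t χ = some v)
    (s : L.Term V) (δ : List ℕ) :
    subtermAt (replaceAt t (χ ++ δ) s) χ = some (replaceAt v δ s) := by
  induction χ generalizing t with
  | nil =>
    rw [subtermAt_nil] at h
    simp [Option.some.inj h]
  | cons i χ ih =>
    cases t with
    | var x => simp at h
    | @func n f ts =>
      rw [subtermAt_func_cons] at h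
      split_ifs at h with hi
      simp only [replaceAt_func_cons, List.cons_append, subtermAt_func_cons, hi, dite_true,
        if_true]
      exact ih h

theorem subtermAt_subst {t u : L.Term V} {π : List ℕ} (h : subtermAt t π = some u)
    (σ : V → L.Term V) : subtermAt (t.subst σ) π = some (u.subst σ) := by
  induction π generalizing t with
  | nil =>
    rw [subtermAt_nil] at h
    simp [Option.some.inj h]
  | cons i π ih =>
    cases t with
    | var x => simp at h
    | @func n f ts =>
      rw [subtermAt_func_cons] at h
      split_ifs at h with hi
      simp only [Language.Term.subst, subtermAt_func_cons, hi, dite_true]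
      exact ih h

/-- Variable positions are minimal: no position extends them. -/
theorem varPos_eq_of_append_eq {t : L.Term V} {ρ₁ ρ₂ τ₁ τ₂ : List ℕ} (h₁ : ρ₁ ∈ varPos t)
    (h₂ : ρ₂ ∈ varPos t) (h : ρ₁ ++ τ₁ = ρ₂ ++ τ₂) : ρ₁ = ρ₂ := by
  have key : ∀ {ρ₁ ρ₂ : List ℕ}, ρ₁ ∈ varPos t → ρ₂ ∈ varPos t → ρ₁ <+: ρ₂ → ρ₁ = ρ₂ := by
    rintro ρ₁ _ ⟨x, hx⟩ ⟨y, hy⟩ ⟨τ, rfl⟩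
    rw [subtermAt_append_of_eq_some hx] at hy
    cases τ with
    | nil => simp
    | cons i τ => simp at hy
  rcases List.prefix_or_prefix_of_prefix ⟨τ₁, rfl⟩ ⟨τ₂, h.symm⟩ with h' | h'
  · exact key h₁ h₂ h'
  · exact (key h₂ h₁ h').symm

theorem finite_positions (t : L.Term V) : {π | subtermAt t π ≠ none}.Finite := by
  induction t with
  | var x =>
    refine (Set.finite_singleton []).subset ?_
    rintro (_ | ⟨i, π⟩) h
    · rfl
    · simp at h
  | @func n f ts ih =>
    refine ((Set.finite_singleton []).union (Set.finite_iUnion fun i : Fin n =>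
      (ih i).image (fun π => (i : ℕ) :: π))).subset ?_
    rintro (_ | ⟨i, π⟩) h
    · exact Or.inl rfl
    · by_cases hi : i < n
      · refine Or.inr (Set.mem_iUnion.2 ⟨⟨i, hi⟩, π, ?_, rfl⟩)
        simpa [subtermAt_func_cons, hi] using h
      · simp [subtermAt_func_cons, hi] at h

end Terms

/-! ### Annotations -/

section Annotations

variable {L : Language} {D : ∀ n, Set (L.Functions n)} {V : Type*}

@[simp] theorem unsharp_plainSym {n : ℕ} (f : L.Functions n) :
    unsharp (plainSym (D := D) f) = f := rfl

theorem plainSym_ne_sharpSym {n : ℕ} (f : L.Functions n) (g : D n) :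
    plainSym (D := D) f ≠ sharpSym g := by
  rintro ⟨⟩

theorem subtermAt_flat (s : ATerm L D V) (π : List ℕ) :
    subtermAt (flat s) π = (subtermAt s π).map flat := by
  induction π generalizing s with
  | nil => simp
  | cons i π ih =>
    cases s with
    | var x => simp [flat]
    | @func n f ts =>
      simp only [flat, subtermAt_func_cons]
      split_ifs
      · exact ih _
      · rfl

theorem subtermAt_flat_eq_some {s : ATerm L D V} {π : List ℕ} {t : L.Term V}
    (h : subtermAt (flat s) π = some t) : ∃ u, subtermAt s π = some u ∧ flat u = t := by
  rw [subtermAt_flat] at h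
  exact Option.map_eq_some_iff.1 h

theorem flat_replaceAt (s : ATerm L D V) (π : List ℕ) (u : ATerm L D V) :
    flat (replaceAt s π u) = replaceAt (flat s) π (flat u) := by
  induction π generalizing s with
  | nil => simp
  | cons i π ih =>
    cases s with
    | var x => rfl
    | @func n f ts =>
      simp only [flat, replaceAt_func_cons]
      congr 1
      funext j
      split_ifs
      · exact ih _
      · rfl

@[simp] theorem disannoAbove_nil (s : ATerm L D V) : disannoAbove s [] = s := by
  cases s <;> rfl

@[simp] theorem flat_disannoAbove (s : ATerm L D V) (π : List ℕ) :
    flat (disannoAbove s π) = flat s := by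
  induction π generalizing s with
  | nil => simp
  | cons i π ih =>
    cases s with
    | var x => rfl
    | @func n f ts =>
      simp only [flat, disannoAbove, unsharp_plainSym]
      congr 1
      funext j
      split_ifs
      · exact ih _
      · rfl

@[simp] theorem flat_anno (t : L.Term V) (Φ : Set (List ℕ)) :
    flat (anno (D := D) t Φ) = t := by
  induction t generalizing Φ with
  | var x => rfl
  | func f ts ih =>
    simp only [anno, flat, ih]
    split_ifs <;> rfl

theorem subtermAt_anno (t : L.Term V) (Φ : Set (List ℕ)) (π : List ℕ) :
    subtermAt (anno (D := D) t Φ) π =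
      (subtermAt t π).map (fun u => anno u {χ | π ++ χ ∈ Φ}) := by
  induction π generalizing t Φ with
  | nil => simp
  | cons i π ih =>
    cases t with
    | var x => simp [anno]
    | @func n f ts =>
      simp only [anno, subtermAt_func_cons]
      split_ifs
      all_goals first | exact ih _ _ | rfl

/-- `AnnRoot s`: the root of `s` is an annotated symbol. -/
def AnnRoot (s : ATerm L D V) : Prop :=
  ∃ (n : ℕ) (f : D n) (ts : Fin n → ATerm L D V), s = .func (sharpSym f) ts

theorem mem_annPos_iff (s : ATerm L D V) (π : List ℕ) :
    π ∈ annPos s ↔ ∃ u, subtermAt s π = some u ∧ AnnRoot u := by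
  constructor
  · rintro ⟨n, f, ts, h⟩
    exact ⟨_, h, n, f, ts, rfl⟩
  · rintro ⟨_, h, n, f, ts, rfl⟩
    exact ⟨n, f, ts, h⟩

theorem mem_annPos_of_subtermAt {s u : ATerm L D V} {π : List ℕ} (h : subtermAt s π = some u)
    (τ : List ℕ) : π ++ τ ∈ annPos s ↔ τ ∈ annPos u := by
  simp only [mem_annPos_iff, subtermAt_append_of_eq_some h]

/-- `DefRoot t`: the root of `t` is a defined symbol. -/
def DefRoot (D : ∀ n, Set (L.Functions n)) (t : L.Term V) : Prop :=
  ∃ (n : ℕ) (f : L.Functions n) (ts : Fin n → L.Term V), f ∈ D n ∧ t = .func f ts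

theorem DefRoot.subst {t : L.Term V} (h : DefRoot D t) (σ : V → L.Term V) :
    DefRoot D (t.subst σ) := by
  obtain ⟨n, f, ts, hf, rfl⟩ := h
  exact ⟨n, f, _, hf, rfl⟩

theorem AnnRoot.defRoot {s : ATerm L D V} (h : AnnRoot s) : DefRoot D (flat s) := by
  obtain ⟨n, f, ts, rfl⟩ := h
  exact ⟨n, f, _, f.2, rfl⟩

theorem annRoot_anno_iff (t : L.Term V) (Φ : Set (List ℕ)) :
    AnnRoot (anno (D := D) t Φ) ↔ [] ∈ Φ ∧ DefRoot D t := by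
  cases t with
  | var x =>
    constructor
    · rintro ⟨n, f, ts, h⟩
      simp [anno] at h
    · rintro ⟨-, n, f, ts, -, h⟩
      simp at h
  | @func n f ts =>
    by_cases h : [] ∈ Φ ∧ f ∈ D n
    · refine iff_of_true ?_ ⟨h.1, n, f, ts, h.2, rfl⟩
      exact ⟨n, ⟨f, h.2⟩, _, by rw [anno, dif_pos h]⟩
    · refine iff_of_false ?_ ?_
      · rintro ⟨m, g, us, hg⟩
        rw [anno, dif_neg h] at hg
        injection hg with h1 h2 h3
        subst h1
        exact plainSym_ne_sharpSym _ _ (eq_of_heq h2)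
      · rintro ⟨h0, m, g, us, hg, he⟩
        injection he with h1 h2 h3
        subst h1
        obtain rfl := eq_of_heq h2
        exact h ⟨h0, hg⟩

theorem mem_annPos_anno_iff (t : L.Term V) (Φ : Set (List ℕ)) (π : List ℕ) :
    π ∈ annPos (anno (D := D) t Φ) ↔
      π ∈ Φ ∧ ∃ u, subtermAt t π = some u ∧ DefRoot D u := by
  simp only [mem_annPos_iff, subtermAt_anno, Option.map_eq_some_iff]
  constructor
  · rintro ⟨_, ⟨u, hu, rfl⟩, h⟩
    have := (annRoot_anno_iff _ _).1 h
    exact ⟨by simpa using this.1, u, hu, this.2⟩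
  · rintro ⟨hΦ, u, hu, h⟩
    exact ⟨_, ⟨u, hu, rfl⟩, (annRoot_anno_iff _ _).2 ⟨by simpa using hΦ, h⟩⟩

theorem exists_defRoot_of_mem_annPos {s : ATerm L D V} {π : List ℕ} (h : π ∈ annPos s) :
    ∃ u, subtermAt (flat s) π = some u ∧ DefRoot D u := by
  obtain ⟨u, hu, h⟩ := (mem_annPos_iff _ _).1 h
  exact ⟨flat u, by simp [subtermAt_flat, hu], h.defRoot⟩

theorem finite_annPos (s : ATerm L D V) : (annPos s).Finite := by
  refine (finite_positions s).subset ?_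
  rintro π ⟨n, f, ts, h⟩
  simp [h]

theorem mem_annPos_replaceAt_append {s u : ATerm L D V} {π : List ℕ}
    (h : subtermAt s π = some u) (v : ATerm L D V) (τ : List ℕ) :
    π ++ τ ∈ annPos (replaceAt s π v) ↔ τ ∈ annPos v := by
  simp only [mem_annPos_iff, subtermAt_replaceAt_append h]

theorem mem_annPos_replaceAt_of_not_prefix {s u : ATerm L D V} {π χ : List ℕ}
    (hu : subtermAt s π = some u) (h : ¬ π <+: χ) (v : ATerm L D V) :
    χ ∈ annPos (replaceAt s π v) ↔ χ ∈ annPos s := by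
  by_cases h' : χ <+: π
  · obtain ⟨δ, rfl⟩ := h'
    cases δ with
    | nil => simp at h
    | cons i δ =>
      rw [subtermAt_append] at hu
      obtain ⟨w, hw, hwu⟩ := Option.bind_eq_some_iff.1 hu
      simp only [mem_annPos_iff, subtermAt_replaceAt_above hw, hw]
      cases w with
      | var x => simp at hwu
      | @func n f ts =>
        simp only [replaceAt_func_cons, Option.some.injEq, exists_eq_left']
        constructor <;>
        · rintro ⟨m, g, us, hg⟩
          injection hg with h1 h2 h3
          subst h1
          obtain rfl := eq_of_heq h2
          exact ⟨_, _, _, rfl⟩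
  · simp only [mem_annPos_iff, subtermAt_replaceAt_of_incomparable _ _ h h']

theorem mem_annPos_disannoAbove_iff {s u : ATerm L D V} {π : List ℕ}
    (hu : subtermAt s π = some u) (χ : List ℕ) :
    χ ∈ annPos (disannoAbove s π) ↔ χ ∈ annPos s ∧ (χ <+: π → χ = π) := by
  induction π generalizing s χ with
  | nil =>
    simp
  | cons i π ih =>
    cases s with
    | var x => simp at hu
    | @func n f ts =>
      rw [subtermAt_func_cons] at hu
      split_ifs at hu with hi
      cases χ with
      | nil =>
        refine iff_of_false ?_ (by simp)
        rintro ⟨m, g, us, hg⟩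
        rw [disannoAbove, subtermAt_nil] at hg
        injection hg with hg
        injection hg with h1 h2 h3
        subst h1
        exact plainSym_ne_sharpSym _ _ (eq_of_heq h2)
      | cons j χ =>
        simp only [mem_annPos_iff, disannoAbove, subtermAt_func_cons, List.cons_prefix_cons,
          List.cons.injEq]
        split_ifs with hj hji
        · subst hji
          have := ih hu χ
          simp only [mem_annPos_iff] at this
          simp only [this, true_and]
        · simp [hji]
        · simp

end Annotations

/-! ### Contracting a redex -/

section Contraction

variable {L : Language} {D : ∀ n, Set (L.Functions n)} {V : Type*}

/-- The result of contracting the redex `u` at position `π` of `s` to the instance `σ` of the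
right-hand side `r`; `m` is the flag of the ADP and `a` says whether the redex is annotated. -/
noncomputable def contract (m : Bool) (a : Prop) (ℓ : L.Term V) (s : ATerm L D V) (π : List ℕ)
    (u r : ATerm L D V) (φ : List ℕ → Option (List ℕ)) (σ : V → L.Term V) : ATerm L D V :=
  if m = true then
    replaceAt s π (anno ((flat r).subst σ) ({τ | a ∧ τ ∈ annPos r} ∪ keptPos ℓ u φ))
  else
    disannoAbove
      (replaceAt s π (anno ((flat r).subst σ) ({τ | a ∧ τ ∈ annPos r} ∪ keptPos ℓ u φ))) π

/-- An annotation at `χ` outside the pattern of the redex at `π` reappears at `χ'` after the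
contraction. -/
def Kept (m : Bool) (ℓ : L.Term V) (π : List ℕ) (φ : List ℕ → Option (List ℕ))
    (χ χ' : List ℕ) : Prop :=
  (χ' = χ ∧ ¬ π <+: χ ∧ (m = false → ¬ χ <+: π)) ∨
    ∃ ρ ∈ varPos ℓ, ∃ ρ' τ, φ ρ = some ρ' ∧ χ = π ++ (ρ ++ τ) ∧ χ' = π ++ (ρ' ++ τ)

/-- A kept annotation is not duplicated. -/
theorem Kept.unique {m : Bool} {ℓ : L.Term V} {π : List ℕ} {φ : List ℕ → Option (List ℕ)}
    {χ χ₁ χ₂ : List ℕ} (h₁ : Kept m ℓ π φ χ χ₁) (h₂ : Kept m ℓ π φ χ χ₂) : χ₁ = χ₂ := by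
  rcases h₁ with ⟨rfl, h, -⟩ | ⟨ρ, hρ, ρ', τ, hφ, rfl, rfl⟩
  · rcases h₂ with ⟨rfl, -, -⟩ | ⟨ρ, hρ, ρ', τ, hφ, rfl, rfl⟩
    · rfl
    · exact absurd ⟨_, rfl⟩ h
  · rcases h₂ with ⟨rfl, h, -⟩ | ⟨ρ₂, hρ₂, ρ₂', τ₂, hφ₂, he, rfl⟩
    · exact absurd ⟨_, rfl⟩ h
    · have he := List.append_cancel_left he
      obtain rfl := varPos_eq_of_append_eq hρ hρ₂ he
      obtain rfl := List.append_cancel_left he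
      rw [hφ] at hφ₂
      rw [Option.some.inj hφ₂]

theorem nil_notMem_varPos {ℓ : L.Term V} (h : DefRoot D ℓ) : [] ∉ varPos ℓ := by
  rintro ⟨x, hx⟩
  obtain ⟨n, f, ts, -, rfl⟩ := h
  simp at hx

/-- The annotation of the redex itself is not kept, as left-hand sides are not variables. -/
theorem Kept.ne_redex {m : Bool} {ℓ : L.Term V} {π : List ℕ} {φ : List ℕ → Option (List ℕ)}
    {χ χ' : List ℕ} (hℓ : DefRoot D ℓ) (h : Kept m ℓ π φ χ χ') : χ ≠ π := by
  rintro rfl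
  rcases h with ⟨-, h, -⟩ | ⟨ρ, hρ, ρ', τ, -, h, -⟩
  · exact h List.prefix_rfl
  · have : ρ ++ τ = [] := by simpa using h
    rw [(List.append_eq_nil_iff.1 this).1] at hρ
    exact nil_notMem_varPos hℓ hρ

/-- Without annotations, a contraction is an ordinary rewrite step. -/
theorem flat_contract (m : Bool) (a : Prop) (ℓ : L.Term V) (s : ATerm L D V) (π : List ℕ)
    (u r : ATerm L D V) (φ : List ℕ → Option (List ℕ)) (σ : V → L.Term V) :
    flat (contract m a ℓ s π u r φ σ) = replaceAt (flat s) π ((flat r).subst σ) := by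
  unfold contract
  split_ifs <;> simp [flat_replaceAt]

/-- Below the image `φ ρ` of a variable position `ρ`, the contractum agrees with the redex
below `ρ`. -/
theorem IsVRF.subtermAt_subst {ℓ : L.Term V} {r : ATerm L D V} {φ : List ℕ → Option (List ℕ)}
    (h : IsVRF ℓ r φ) {ρ ρ' : List ℕ} (hρ : ρ ∈ varPos ℓ) (hφ : φ ρ = some ρ')
    (σ : V → L.Term V) (τ : List ℕ) :
    subtermAt ((flat r).subst σ) (ρ' ++ τ) = subtermAt (ℓ.subst σ) (ρ ++ τ) := by
  obtain ⟨x, hx, hx'⟩ := h ρ hρ ρ' hφ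
  have h₂ : subtermAt (flat r) ρ' = some (.var x) := by simp [subtermAt_flat, hx', flat]
  rw [subtermAt_append_of_eq_some (ProbADP.subtermAt_subst h₂ σ),
    subtermAt_append_of_eq_some (ProbADP.subtermAt_subst hx σ)]

/-- The annotations after a contraction are those that are kept and, if the redex is annotated,
those of the right-hand side. -/
theorem mem_annPos_contract_iff {m : Bool} {a : Prop} {ℓ : L.Term V} {s : ATerm L D V}
    {π : List ℕ} {u r : ATerm L D V} {φ : List ℕ → Option (List ℕ)} {σ : V → L.Term V}
    (hu : subtermAt s π = some u) (hflat : flat u = ℓ.subst σ) (hφ : IsVRF ℓ r φ)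
    (χ' : List ℕ) :
    χ' ∈ annPos (contract m a ℓ s π u r φ σ) ↔
      (∃ χ ∈ annPos s, Kept m ℓ π φ χ χ') ∨ (a ∧ ∃ τ ∈ annPos r, χ' = π ++ τ) := by
  have hmid : ∀ v : ATerm L D V, subtermAt (replaceAt s π v) π = some v := by
    intro v
    simpa using subtermAt_replaceAt_append hu v []
  have hm : χ' ∈ annPos (contract m a ℓ s π u r φ σ) ↔
      χ' ∈ annPos (replaceAt s π (anno ((flat r).subst σ)
        ({τ | a ∧ τ ∈ annPos r} ∪ keptPos ℓ u φ))) ∧ (m = false → χ' <+: π → χ' = π) := by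
    unfold contract
    cases m with
    | true => simp
    | false => simp [mem_annPos_disannoAbove_iff (hmid _)]
  rw [hm]
  by_cases hp : π <+: χ'
  · obtain ⟨τ, rfl⟩ := hp
    have htriv : π ++ τ <+: π → π ++ τ = π := fun h =>
      (h.eq_of_length_le (by simp))
    rw [mem_annPos_replaceAt_append hu, mem_annPos_anno_iff, and_iff_left (fun _ => htriv)]
    constructor
    · rintro ⟨⟨ha, hτ⟩ | ⟨ρ, hρ, ρ', τ', hφρ, hτ', rfl⟩, -⟩
      · exact Or.inr ⟨ha, τ, hτ, rfl⟩
      · exact Or.inl ⟨_, (mem_annPos_of_subtermAt hu _).2 hτ', Or.inr ⟨ρ, hρ, ρ', τ', hφρ, rfl, rfl⟩⟩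
    · rintro (⟨χ, hχ, ⟨rfl, h, -⟩ | ⟨ρ, hρ, ρ', τ', hφρ, rfl, he⟩⟩ | ⟨ha, τ', hτ', he⟩)
      · exact absurd ⟨_, rfl⟩ h
      · obtain rfl := List.append_cancel_left he
        have hmem := (mem_annPos_of_subtermAt hu _).1 hχ
        refine ⟨Or.inr ⟨ρ, hρ, ρ', τ', hφρ, hmem, rfl⟩, ?_⟩
        rw [hφ.subtermAt_subst hρ hφρ, ← hflat]
        exact exists_defRoot_of_mem_annPos hmem
      · obtain rfl := List.append_cancel_left he
        refine ⟨Or.inl ⟨ha, hτ'⟩, ?_⟩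
        obtain ⟨v, hv, hd⟩ := exists_defRoot_of_mem_annPos hτ'
        exact ⟨_, subtermAt_subst hv σ, hd.subst σ⟩
  · rw [mem_annPos_replaceAt_of_not_prefix hu hp]
    constructor
    · rintro ⟨h, h'⟩
      refine Or.inl ⟨χ', h, Or.inl ⟨rfl, hp, fun hf hpre => hp ?_⟩⟩
      rw [h' hf hpre]
    · rintro (⟨χ, hχ, ⟨rfl, -, h⟩ | ⟨ρ, hρ, ρ', τ', hφρ, rfl, rfl⟩⟩ | ⟨ha, τ', hτ', rfl⟩)
      · exact ⟨hχ, fun hf hpre => absurd hpre (h hf)⟩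
      · exact absurd ⟨_, rfl⟩ hp
      · exact absurd ⟨_, rfl⟩ hp

/-- A rewrite step of `s` to the multi-distribution of the `(q w, t w)` for `w ∈ S`, with the data
of the step indexed by `S`. -/
structure StepData (P : ADPProblem L D V) (a : Prop) (s : ATerm L D V) {N : Type*} (S : Finset N)
    (q : N → ℝ) (t : N → ATerm L D V) where
  /-- The applied ADP. -/
  rule : ADP L D V
  rule_mem : rule ∈ P
  /-- The right-hand sides of the applied ADP. -/
  r : N → ATerm L D V
  rhs_eq : rule.rhs = S.val.map (fun w => (q w, r w))
  /-- The variable reposition functions. -/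
  φ : N → List ℕ → Option (List ℕ)
  vrf : ∀ w ∈ S, IsVRF rule.lhs (r w) (φ w)
  /-- The matching substitution. -/
  σ : V → L.Term V
  isSubst : IsSubst σ
  /-- The position of the redex. -/
  π : List ℕ
  /-- The redex. -/
  u : ATerm L D V
  subterm_eq : subtermAt s π = some u
  flat_eq : flat u = rule.lhs.subst σ
  ann_iff : a ↔ π ∈ annPos s
  term_eq : ∀ w ∈ S, t w = contract rule.flag a rule.lhs s π u (r w) (φ w) σ

theorem exists_map_of_rel {A B N : Type*} {R : A → B → Prop} {S : Finset N} {f : N → A}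
    {t : Multiset B} [Nonempty B] (h : Multiset.Rel R (S.val.map f) t) :
    ∃ g : N → B, t = S.val.map g ∧ ∀ w ∈ S, R (f w) (g w) := by
  classical
  induction S using Finset.induction_on generalizing t with
  | empty =>
    refine ⟨fun _ => Classical.arbitrary B, ?_, by simp⟩
    simpa using h
  | insert a S ha ih =>
    rw [Finset.insert_val_of_notMem ha, Multiset.map_cons, Multiset.rel_cons_left] at h
    obtain ⟨b, t', hb, h', rfl⟩ := h
    obtain ⟨g, rfl, hg⟩ := ih h'
    refine ⟨Function.update g a b, ?_, ?_⟩
    · rw [Finset.insert_val_of_notMem ha, Multiset.map_cons, Function.update_self]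
      congr 1
      refine Multiset.map_congr rfl fun w hw => ?_
      rw [Function.update_of_ne]
      rintro rfl
      exact ha hw
    · intro w hw'
      rcases Finset.mem_insert.1 hw' with rfl | hw
      · simpa using hb
      · rw [Function.update_of_ne]
        · exact hg w hw
        · rintro rfl
          exact ha ‹_›

/-- The branches of a rewrite step can be indexed by any enumeration of its multi-distribution. -/
theorem Step.exists_stepData {P : ADPProblem L D V} {a : Prop} {s : ATerm L D V} {N : Type*}
    {S : Finset N} {q : N → ℝ} {t : N → ATerm L D V}
    (h : Step P a s (S.val.map (fun w => (q w, t w)))) : Nonempty (StepData P a s S q t) := by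
  obtain ⟨α, hα, k, p, r, hr, φ, hφ, σ, hσ, π, hπ, u, hu, hf, ha, t', ht', hμ⟩ := h
  have hk : Nonempty (Fin k) := by
    by_contra hk
    rw [not_nonempty_iff] at hk
    have := α.rhs_dist.2
    rw [hr] at this
    simp at this
  -- Both sides of `hμ` enumerate the same multiset; `J w` is the index of the branch to `w`.
  have hrel : Multiset.Rel (fun x j => x = (p j, if α.flag = true then t' j
      else disannoAbove (t' j) π)) (S.val.map (fun w => (q w, t w))) Finset.univ.val := by
    rw [hμ, Multiset.rel_map_left]
    exact Multiset.rel_refl_of_refl_on fun j _ => rfl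
  obtain ⟨J, hJ, hJS⟩ := exists_map_of_rel hrel
  refine ⟨⟨α, hα, fun w => r (J w), ?_, fun w => φ (J w), fun w _ => hφ _,
    σ, hσ, π, u, hu, hf, ha, fun w hw => ?_⟩⟩
  · rw [hr, hJ, Multiset.map_map]
    refine Multiset.map_congr rfl fun w hw => ?_
    have h : q w = p (J w) := congrArg Prod.fst (hJS w hw)
    rw [h]
    rfl
  · have h : t w = if α.flag = true then t' (J w) else disannoAbove (t' (J w)) π :=
      congrArg Prod.snd (hJS w hw)
    rw [h, ht']
    rfl

theorem exists_fin_enumeration {N : Type*} (S : Finset N) :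
    ∃ e : Fin S.card → N, (∀ j, e j ∈ S) ∧ S.val = Finset.univ.val.map e := by
  refine ⟨fun j => (S.equivFin.symm j : N), fun j => (S.equivFin.symm j).2, ?_⟩
  have : S = Finset.univ.map (S.equivFin.symm.toEmbedding.trans (Function.Embedding.subtype _)) := by
    ext w
    simp only [Finset.mem_map, Finset.mem_univ, true_and]
    constructor
    · intro hw
      exact ⟨S.equivFin ⟨w, hw⟩, by simp⟩
    · rintro ⟨j, rfl⟩
      exact (S.equivFin.symm j).2
  conv_lhs => rw [this]
  rfl

theorem StepData.step {P : ADPProblem L D V} {a : Prop} {s : ATerm L D V} {N : Type*}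
    {S : Finset N} {q : N → ℝ} {t : N → ATerm L D V} (d : StepData P a s S q t) :
    Step P a s (S.val.map (fun w => (q w, t w))) := by
  obtain ⟨e, heS, he⟩ := exists_fin_enumeration S
  refine ⟨d.rule, d.rule_mem, S.card, fun j => q (e j), fun j => d.r (e j), ?_,
    fun j => d.φ (e j), fun j => d.vrf _ (heS j), d.σ, d.isSubst, d.π, ?_, d.u, d.subterm_eq,
    d.flat_eq, d.ann_iff, _, fun j => rfl, ?_⟩
  · rw [d.rhs_eq, he, Multiset.map_map]
    rfl
  · obtain ⟨n, f, ts, hf, he⟩ := d.rule.lhs_root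
    have hu := d.flat_eq
    rw [he] at hu
    cases h : d.u with
    | var x => rw [h] at hu; simp [flat, Language.Term.subst] at hu
    | @func m g us =>
      rw [h] at hu
      simp only [flat, Language.Term.subst] at hu
      injection hu with h1 h2 h3
      subst h1
      refine ⟨_, g, us, ?_, by rw [d.subterm_eq, h]⟩
      rwa [eq_of_heq h2]
  · rw [he, Multiset.map_map]
    refine Multiset.map_congr rfl fun j _ => ?_
    simp only [Function.comp]
    rw [d.term_eq _ (heS j)]
    rfl

/-- The annotation at `χ` of the term `s` gives rise to the annotation at `χ'` of the successor
`w`: either it is kept, or it is the annotation of the redex and `χ'` stems from the right-hand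
side of the applied ADP. -/
def StepData.Descends {P : ADPProblem L D V} {a : Prop} {s : ATerm L D V} {N : Type*}
    {S : Finset N} {q : N → ℝ} {t : N → ATerm L D V} (d : StepData P a s S q t) (w : N)
    (χ χ' : List ℕ) : Prop :=
  Kept d.rule.flag d.rule.lhs d.π (d.φ w) χ χ' ∨ (χ = d.π ∧ ∃ τ ∈ annPos (d.r w), χ' = d.π ++ τ)

/-- The annotations after a step are the descendants of those before it. -/
theorem StepData.mem_annPos_iff {P : ADPProblem L D V} {a : Prop} {s : ATerm L D V} {N : Type*}
    {S : Finset N} {q : N → ℝ} {t : N → ATerm L D V} (d : StepData P a s S q t) {w : N}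
    (hw : w ∈ S) (χ' : List ℕ) :
    χ' ∈ annPos (t w) ↔ ∃ χ ∈ annPos s, d.Descends w χ χ' := by
  rw [d.term_eq w hw, mem_annPos_contract_iff d.subterm_eq d.flat_eq (d.vrf w hw)]
  constructor
  · rintro (⟨χ, hχ, h⟩ | ⟨ha, h⟩)
    · exact ⟨χ, hχ, Or.inl h⟩
    · exact ⟨d.π, d.ann_iff.1 ha, Or.inr ⟨rfl, h⟩⟩
  · rintro ⟨χ, hχ, h | ⟨rfl, h⟩⟩
    · exact Or.inl ⟨χ, hχ, h⟩
    · exact Or.inr ⟨d.ann_iff.2 hχ, h⟩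

/-! ### Changing the annotations of a rewrite step -/

/-- Every ADP of `P` has a counterpart in `Q` that differs only in the annotations of the
right-hand sides, and that has at least the same annotations if the ADP lies in `keep`. -/
def Refines (keep : Set (ADP L D V)) (P Q : ADPProblem L D V) : Prop :=
  ∀ α ∈ P, ∃ β ∈ Q, β.lhs = α.lhs ∧ β.flag = α.flag ∧
    Multiset.Rel (fun x y => x.1 = y.1 ∧ flat x.2 = flat y.2 ∧
      (α ∈ keep → annPos x.2 ⊆ annPos y.2)) α.rhs β.rhs

theorem exists_map_of_rel_fst_eq {A B N : Type*} [Nonempty B] {R : ℝ × A → ℝ × B → Prop}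
    (hR : ∀ x y, R x y → x.1 = y.1) {S : Finset N} {q : N → ℝ} {f : N → A}
    {t : Multiset (ℝ × B)} (h : Multiset.Rel R (S.val.map (fun w => (q w, f w))) t) :
    ∃ g : N → B, t = S.val.map (fun w => (q w, g w)) ∧ ∀ w ∈ S, R (q w, f w) (q w, g w) := by
  obtain ⟨g, rfl, hg⟩ := exists_map_of_rel h
  have hq : ∀ w ∈ S, g w = (q w, (g w).2) := fun w hw => Prod.ext (hR _ _ (hg w hw)).symm rfl
  exact ⟨fun w => (g w).2, Multiset.map_congr rfl hq, fun w hw => hq w hw ▸ hg w hw⟩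

/-- A rewrite step of `s` can be performed with counterparts of the ADPs on every variant `s'` of
`s` with other annotations. Kept annotations stay kept, and the annotations created by the ADPs
in `keep` are still created if the redex is annotated in `s'`. -/
theorem StepData.exists_retarget {P Q : ADPProblem L D V} {keep : Set (ADP L D V)}
    (hPQ : Refines keep P Q) {a : Prop} {s s' : ATerm L D V} {N : Type*} {S : Finset N}
    {q : N → ℝ} {t : N → ATerm L D V} (d : StepData P a s S q t) (hs : flat s' = flat s) :
    ∃ t' : N → ATerm L D V, Step Q (d.π ∈ annPos s') s' (S.val.map (fun w => (q w, t' w))) ∧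
      ∀ w ∈ S, flat (t' w) = flat (t w) ∧
        ∀ χ ∈ annPos s', ∀ χ', d.Descends w χ χ' → (χ = d.π → d.rule ∈ keep) →
          χ' ∈ annPos (t' w) := by
  obtain ⟨β, hβ, hlhs, hflag, hrel⟩ := hPQ d.rule d.rule_mem
  rw [d.rhs_eq] at hrel
  have : Nonempty (ATerm L D V) := ⟨s⟩
  obtain ⟨r', hr', hrr'⟩ := exists_map_of_rel_fst_eq (fun x y h => h.1) hrel
  have hu : subtermAt (flat s') d.π = some (flat d.u) := by
    rw [hs, subtermAt_flat, d.subterm_eq]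
    rfl
  obtain ⟨u', hu', hflat⟩ := subtermAt_flat_eq_some hu
  have hvrf : ∀ w ∈ S, IsVRF β.lhs (r' w) (d.φ w) := by
    intro w hw ρ hρ ρ' hφ
    rw [hlhs] at hρ ⊢
    obtain ⟨x, hx, hx'⟩ := d.vrf w hw ρ hρ ρ' hφ
    refine ⟨x, hx, ?_⟩
    have h1 : subtermAt (flat (r' w)) ρ' = some (.var x) := by
      rw [← (hrr' w hw).2.1, subtermAt_flat, hx']
      rfl
    obtain ⟨v, hv, hvx⟩ := subtermAt_flat_eq_some h1
    cases v with
    | var y => simpa [flat] using hv.trans (congrArg some (by simpa [flat] using hvx))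
    | func f ts => simp [flat] at hvx
  let d' : StepData Q (d.π ∈ annPos s') s' S q (fun w =>
      contract β.flag (d.π ∈ annPos s') β.lhs s' d.π u' (r' w) (d.φ w) d.σ) :=
    ⟨β, hβ, r', hr', d.φ, hvrf, d.σ, d.isSubst, d.π, u', hu', by rw [hflat, d.flat_eq, hlhs],
      Iff.rfl, fun w _ => rfl⟩
  refine ⟨_, d'.step, fun w hw => ⟨?_, ?_⟩⟩
  · rw [d.term_eq w hw, flat_contract, flat_contract, hs, ← (hrr' w hw).2.1]
  · intro χ hχ χ' h hk
    refine (d'.mem_annPos_iff hw χ').2 ⟨χ, hχ, ?_⟩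
    rcases h with h | ⟨rfl, τ, hτ, rfl⟩
    · refine Or.inl ?_
      simp only [d', hlhs, hflag]
      exact h
    · exact Or.inr ⟨rfl, τ, (hrr' w hw).2.2 (hk rfl) hτ, rfl⟩

end Contraction

/-! ### Rooted trees -/

/-- A finitely branching rooted tree. -/
structure RootedTree (N : Type*) where
  /-- The root of the tree. -/
  root : N
  /-- The successors of a node. -/
  children : N → Finset N
  root_not_child : ∀ v, root ∉ children v
  parent_unique : ∀ v v' w, w ∈ children v → w ∈ children v' → v = v'
  reachable : ∀ v, Relation.ReflTransGen (fun x y => y ∈ children x) root v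

namespace RootedTree

variable {N : Type*} (T : RootedTree N)

/-- `u` is an ancestor of `w`, possibly `w` itself. -/
def Anc (u w : N) : Prop := Relation.ReflTransGen (fun x y => y ∈ T.children x) u w

/-- Functions on the nodes of a tree can be defined by recursion along the edges. -/
theorem exists_recursion {β : Type*} (b : β) (f : N → N → β → β) :
    ∃ g : N → β, g T.root = b ∧ ∀ v, ∀ w ∈ T.children v, g w = f v w (g v) := by
  let G : N → β → Prop := fun w y => ∀ R : N → β → Prop, R T.root b →
    (∀ v, ∀ w ∈ T.children v, ∀ y, R v y → R w (f v w y)) → R w y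
  have hroot : G T.root b := fun R h _ => h
  have hstep : ∀ v, ∀ w ∈ T.children v, ∀ y, G v y → G w (f v w y) :=
    fun v w hw y h R h₁ h₂ => h₂ v w hw y (h R h₁ h₂)
  have hinv : ∀ w y, G w y → (w = T.root ∧ y = b) ∨
      ∃ v, w ∈ T.children v ∧ ∃ y', G v y' ∧ y = f v w y' := by
    intro w y h
    refine (h (fun w y => G w y ∧ ((w = T.root ∧ y = b) ∨
      ∃ v, w ∈ T.children v ∧ ∃ y', G v y' ∧ y = f v w y'))
      ⟨hroot, Or.inl ⟨rfl, rfl⟩⟩ ?_).2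
    intro v w hw y h
    exact ⟨hstep v w hw y h.1, Or.inr ⟨v, hw, y, h.1, rfl⟩⟩
  have huniq : ∀ w, ∃! y, G w y := by
    intro w
    induction T.reachable w with
    | refl =>
      refine ⟨b, hroot, fun y hy => ?_⟩
      rcases hinv _ _ hy with ⟨-, rfl⟩ | ⟨v, hv, -⟩
      · rfl
      · exact absurd hv (T.root_not_child v)
    | @tail v w _ hw ih =>
      obtain ⟨y, hy, hu⟩ := ih
      refine ⟨f v w y, hstep v w hw y hy, fun z hz => ?_⟩
      rcases hinv _ _ hz with ⟨rfl, -⟩ | ⟨v', hv', y', hy', rfl⟩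
      · exact absurd hw (T.root_not_child v)
      · obtain rfl := T.parent_unique _ _ _ hw hv'
        rw [hu y' hy']
  choose g hg hgu using huniq
  exact ⟨g, (hgu _ _ hroot).symm, fun v w hw => (hgu _ _ (hstep v w hw _ (hg v))).symm⟩

/-- The distance of a node from the root. -/
noncomputable def depth : N → ℕ := (T.exists_recursion 0 (fun _ _ n => n + 1)).choose

theorem depth_root : T.depth T.root = 0 :=
  (T.exists_recursion 0 (fun _ _ n => n + 1)).choose_spec.1

theorem depth_of_mem {v w : N} (h : w ∈ T.children v) : T.depth w = T.depth v + 1 :=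
  (T.exists_recursion 0 (fun _ _ n => n + 1)).choose_spec.2 v w h

variable {T}

theorem Anc.depth_le {u w : N} (h : T.Anc u w) : T.depth u ≤ T.depth w := by
  induction h with
  | refl => exact le_rfl
  | tail _ hw ih => exact ih.trans (by rw [T.depth_of_mem hw]; omega)

theorem Anc.eq_of_depth_le {u w : N} (h : T.Anc u w) (hd : T.depth w ≤ T.depth u) : u = w := by
  rcases Relation.ReflTransGen.cases_tail h with h | ⟨v, hv, hw⟩
  · exact h.symm
  · have := Anc.depth_le (T := T) hv
    rw [T.depth_of_mem hw] at hd
    omega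

variable (T)

theorem eq_root_or_exists_parent (w : N) : w = T.root ∨ ∃ v, w ∈ T.children v := by
  rcases Relation.ReflTransGen.cases_tail (T.reachable w) with h | ⟨v, -, hv⟩
  · exact Or.inl h
  · exact Or.inr ⟨v, hv⟩

theorem exists_anc_of_depth (w : N) {n : ℕ} (h : n ≤ T.depth w) :
    ∃ u, T.Anc u w ∧ T.depth u = n := by
  induction T.reachable w with
  | refl =>
    rw [T.depth_root] at h
    exact ⟨_, Relation.ReflTransGen.refl, by rw [T.depth_root]; omega⟩
  | @tail v w _ hw ih =>
    rcases eq_or_lt_of_le h with rfl | h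
    · exact ⟨w, Relation.ReflTransGen.refl, rfl⟩
    · rw [T.depth_of_mem hw] at h
      obtain ⟨u, hu, hd⟩ := ih (by omega)
      exact ⟨u, hu.tail hw, hd⟩

theorem finite_depth_eq (n : ℕ) : {v | T.depth v = n}.Finite := by
  induction n with
  | zero =>
    refine (Set.finite_singleton T.root).subset fun v hv => ?_
    rcases T.eq_root_or_exists_parent v with h | ⟨u, hu⟩
    · exact h
    · have := T.depth_of_mem hu
      rw [Set.mem_ofPred_eq] at hv
      omega
  | succ n ih =>
    refine (ih.biUnion fun v _ => (T.children v).finite_toSet).subset fun w hw => ?_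
    rw [Set.mem_ofPred_eq] at hw
    rcases T.eq_root_or_exists_parent w with rfl | ⟨u, hu⟩
    · rw [T.depth_root] at hw
      omega
    · have := T.depth_of_mem hu
      exact Set.mem_biUnion (show T.depth u = n by omega) hu

theorem countable (T : RootedTree N) : Countable N := by
  rw [← Set.countable_univ_iff]
  have : (Set.univ : Set N) = ⋃ n, {v | T.depth v = n} := by
    ext v
    simp
  rw [this]
  exact Set.countable_iUnion fun n => (T.finite_depth_eq n).countable

/-- `x` is an infinite path of the tree. -/
def IsPath (x : ℕ → N) : Prop := ∀ n, x (n + 1) ∈ T.children (x n)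

variable {T}

theorem IsPath.depth {x : ℕ → N} (hx : T.IsPath x) (n : ℕ) :
    T.depth (x n) = T.depth (x 0) + n := by
  induction n with
  | zero => rfl
  | succ n ih => rw [T.depth_of_mem (hx n), ih]; omega

theorem IsPath.eq_of_anc {x : ℕ → N} (hx : T.IsPath x) {u : N} {n : ℕ} (h : T.Anc u (x n))
    (hd : T.depth (x 0) ≤ T.depth u) : ∃ m ≤ n, u = x m := by
  induction n with
  | zero => exact ⟨0, le_rfl, h.eq_of_depth_le hd⟩
  | succ n ih =>
    rcases Relation.ReflTransGen.cases_tail h with h | ⟨v, hv, hw⟩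
    · exact ⟨n + 1, le_rfl, h.symm⟩
    · obtain rfl := T.parent_unique _ _ _ hw (hx n)
      obtain ⟨m, hm, h⟩ := ih hv
      exact ⟨m, by omega, h⟩

variable (T)

/-- `w` is reached from `v` along a path that does not pass through a node of `C` before `w`. -/
def CutReach (C : Set N) (v w : N) : Prop :=
  Relation.ReflTransGen (fun x y => x ∉ C ∧ y ∈ T.children x) v w

variable {T}

theorem CutReach.anc {C : Set N} {v w : N} (h : T.CutReach C v w) : T.Anc v w :=
  Relation.ReflTransGen.mono (fun _ _ h => h.2) _ _ h

/-- A node strictly between `v` and a node reached from `v` is neither cut nor a leaf. -/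
theorem CutReach.inner {C : Set N} {v w w' : N} (h : T.CutReach C v w') (ha : T.Anc w w')
    (hd : T.depth v ≤ T.depth w) (hne : w ≠ w') : w ∉ C ∧ T.children w ≠ ∅ := by
  induction h with
  | refl => exact absurd (ha.eq_of_depth_le hd) hne
  | @tail b c hb hc ih =>
    rcases Relation.ReflTransGen.cases_tail ha with h | ⟨b', hb', hw⟩
    · exact absurd h.symm hne
    · obtain rfl := T.parent_unique _ _ _ hw hc.2
      by_cases hwb : w = b'
      · subst hwb
        exact ⟨hc.1, Finset.ne_empty_of_mem hc.2⟩
      · exact ih hb' hwb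

end RootedTree

/-! ### Realizing the nodes of a probability tree by intervals -/

/-- Disjoint half-open intervals of given lengths fill up an interval. -/
theorem exists_intervals {N : Type*} (p : N → ℝ) (hp : ∀ v, 0 < p v) (S : Finset N) :
    ∃ b : N → ℝ, (∀ w ∈ S, ∀ w' ∈ S, w ≠ w' →
        Disjoint (Set.Ico (b w) (b w + p w)) (Set.Ico (b w') (b w' + p w'))) ∧
      ⋃ w ∈ S, Set.Ico (b w) (b w + p w) = Set.Ico 0 (∑ w ∈ S, p w) := by
  classical
  induction S using Finset.induction_on with
  | empty => exact ⟨fun _ => 0, by simp, by simp⟩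
  | insert a S ha ih =>
    obtain ⟨b, hb, hU⟩ := ih
    let c : N → ℝ := Function.update b a (∑ w ∈ S, p w)
    have hc : ∀ w ∈ S, c w = b w := fun w hw =>
      Function.update_of_ne (fun h => ha (by rwa [← h])) _ _
    have hca : c a = ∑ w ∈ S, p w := Function.update_self ..
    have hsub : ∀ w ∈ S, Disjoint (Set.Ico (c a) (c a + p a)) (Set.Ico (c w) (c w + p w)) := by
      intro w hw
      rw [Set.disjoint_left]
      intro x hx hxw
      rw [hc w hw] at hxw
      have : x ∈ ⋃ w ∈ S, Set.Ico (b w) (b w + p w) := Set.mem_biUnion hw hxw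
      rw [hU] at this
      rw [hca] at hx
      exact absurd this.2 (not_lt.2 hx.1)
    refine ⟨c, ?_, ?_⟩
    · intro w hw w' hw' hne
      rcases Finset.mem_insert.1 hw with rfl | h <;> rcases Finset.mem_insert.1 hw' with rfl | h'
      · exact absurd rfl hne
      · exact hsub _ h'
      · exact (hsub _ h).symm
      · rw [hc w h, hc w' h']
        exact hb w h w' h' hne
    · rw [Finset.set_biUnion_insert, Finset.sum_insert ha, hca]
      have : ⋃ w ∈ S, Set.Ico (c w) (c w + p w) = ⋃ w ∈ S, Set.Ico (b w) (b w + p w) :=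
        Set.iUnion₂_congr fun w hw => by rw [hc w hw]
      rw [this, hU, Set.union_comm, add_comm (p a), Set.Ico_union_Ico_eq_Ico]
      · exact Finset.sum_nonneg fun w _ => (hp w).le
      · linarith [hp a]

/-- A rooted tree whose nodes carry positive probabilities, where the probability of an inner node
is distributed among its successors. -/
structure ProbTree (N : Type*) extends RootedTree N where
  /-- The probability of a node. -/
  prob : N → ℝ
  prob_pos : ∀ v, 0 < prob v
  prob_root : prob root = 1
  sum_children : ∀ v, (children v).Nonempty → ∑ w ∈ children v, prob w = prob v

namespace ProbTree

open MeasureTheory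

variable {N : Type*} (T : ProbTree N)

/-- The left end points of intervals that realize the nodes: the interval of a node is divided
among its successors. -/
theorem exists_left : ∃ a : N → ℝ, ∀ v, (T.children v).Nonempty →
    (∀ w ∈ T.children v, ∀ w' ∈ T.children v, w ≠ w' →
      Disjoint (Set.Ico (a w) (a w + T.prob w)) (Set.Ico (a w') (a w' + T.prob w'))) ∧
    ⋃ w ∈ T.children v, Set.Ico (a w) (a w + T.prob w) = Set.Ico (a v) (a v + T.prob v) := by
  choose b hb hU using fun v => exists_intervals T.prob T.prob_pos (T.children v)
  obtain ⟨a, -, hrec⟩ := T.exists_recursion (0 : ℝ) (fun v w y => y + b v w)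
  have hI : ∀ v, ∀ w ∈ T.children v, Set.Ico (a w) (a w + T.prob w) =
      (fun x => a v + x) '' Set.Ico (b v w) (b v w + T.prob w) := by
    intro v w hw
    rw [hrec v w hw, Set.image_const_add_Ico, add_assoc]
  refine ⟨a, fun v hv => ⟨fun w hw w' hw' hne => ?_, ?_⟩⟩
  · rw [hI v w hw, hI v w' hw']
    exact (Set.disjoint_image_iff (add_right_injective _)).2 (hb v w hw w' hw' hne)
  · rw [Set.iUnion₂_congr (hI v), ← Set.image_iUnion₂, hU, Set.image_const_add_Ico,
      T.sum_children v hv, add_zero]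

/-- The interval of length `prob v` that realizes the node `v`. -/
noncomputable def event (v : N) : Set ℝ :=
  Set.Ico (T.exists_left.choose v) (T.exists_left.choose v + T.prob v)

theorem measurableSet_event (v : N) : MeasurableSet (T.event v) := measurableSet_Ico

theorem volume_event (v : N) : volume (T.event v) = ENNReal.ofReal (T.prob v) := by
  simp [event]

theorem iUnion_event {v : N} (h : T.children v ≠ ∅) :
    ⋃ w ∈ T.children v, T.event w = T.event v :=
  (T.exists_left.choose_spec v (Finset.nonempty_iff_ne_empty.2 h)).2

theorem disjoint_event {v w w' : N} (hw : w ∈ T.children v) (hw' : w' ∈ T.children v)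
    (hne : w ≠ w') : Disjoint (T.event w) (T.event w') :=
  (T.exists_left.choose_spec v ⟨w, hw⟩).1 w hw w' hw' hne

theorem event_mono {u w : N} (h : T.Anc u w) : T.event w ⊆ T.event u := by
  induction h with
  | refl => exact subset_rfl
  | @tail v w _ hw ih =>
    refine subset_trans ?_ ih
    rw [← T.iUnion_event (Finset.ne_empty_of_mem hw)]
    exact Set.subset_biUnion_of_mem hw

/-- Different nodes of the same depth are realized by disjoint sets. -/
theorem eq_of_depth_eq {u w : N} {ω : ℝ} (hu : ω ∈ T.event u) (hw : ω ∈ T.event w)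
    (h : T.depth u = T.depth w) : u = w := by
  induction T.reachable u generalizing w with
  | refl =>
    rcases T.eq_root_or_exists_parent w with rfl | ⟨v, hv⟩
    · rfl
    · rw [T.depth_root, T.depth_of_mem hv] at h
      omega
  | @tail v u _ huv ih =>
    rcases T.eq_root_or_exists_parent w with rfl | ⟨v', hv'⟩
    · rw [T.depth_root, T.depth_of_mem huv] at h
      omega
    · rw [T.depth_of_mem hv', T.depth_of_mem huv] at h
      obtain rfl := ih (T.event_mono (Relation.ReflTransGen.single huv) hu)
        (T.event_mono (Relation.ReflTransGen.single hv') hw) (by omega)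
      by_contra hne
      exact Set.disjoint_left.1 (T.disjoint_event huv hv' hne) hu hw

theorem anc_of_depth_le {u w : N} {ω : ℝ} (hu : ω ∈ T.event u) (hw : ω ∈ T.event w)
    (h : T.depth u ≤ T.depth w) : T.Anc u w := by
  obtain ⟨u', hu', hd⟩ := T.exists_anc_of_depth w h
  rwa [T.eq_of_depth_eq hu (T.event_mono hu' hw) hd.symm]

theorem prob_le_of_anc {u w : N} (h : T.Anc u w) : T.prob w ≤ T.prob u := by
  have := measure_mono (μ := volume) (T.event_mono h)
  rwa [T.volume_event, T.volume_event, ENNReal.ofReal_le_ofReal_iff (T.prob_pos u).le] at this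

/-- The points of the event of the root that do not belong to a leaf; they represent infinite
paths. -/
def survivors : Set ℝ := {ω | ω ∈ T.event T.root ∧ ∀ v, T.children v = ∅ → ω ∉ T.event v}

theorem measurableSet_survivors : MeasurableSet T.survivors := by
  have := T.countable
  have h : T.survivors = T.event T.root \ ⋃ (v : N) (_ : T.children v = ∅), T.event v := by
    ext ω
    simp [survivors]
  rw [h]
  exact (T.measurableSet_event _).diff
    (MeasurableSet.iUnion fun v => MeasurableSet.iUnion fun _ => T.measurableSet_event v)

/-- Every surviving point determines an infinite path. -/
theorem exists_path {ω : ℝ} (h : ω ∈ T.survivors) :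
    ∃ x : ℕ → N, x 0 = T.root ∧ T.IsPath x ∧ ∀ n, ω ∈ T.event (x n) := by
  have hstep : ∀ v : {v // ω ∈ T.event v}, ∃ w : {v // ω ∈ T.event v}, w.1 ∈ T.children v.1 := by
    rintro ⟨v, hv⟩
    have hne : T.children v ≠ ∅ := fun he => h.2 v he hv
    rw [← T.iUnion_event hne] at hv
    obtain ⟨w, hw, hω⟩ := Set.mem_iUnion₂.1 hv
    exact ⟨⟨w, hω⟩, hw⟩
  choose f hf using hstep
  let x : ℕ → {v // ω ∈ T.event v} := fun n => f^[n] ⟨T.root, h.1⟩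
  refine ⟨fun n => (x n).1, rfl, fun n => ?_, fun n => (x n).2⟩
  simp only [x, Function.iterate_succ_apply']
  exact hf _

/-- The total probability of a set of pairwise incomparable nodes is the volume of its union. -/
theorem tsum_eq_volume {M : Set N} (h : ∀ w ∈ M, ∀ w' ∈ M, T.Anc w w' → w = w') :
    ∑' w : M, ENNReal.ofReal (T.prob w) = volume (⋃ w : M, T.event w) := by
  have := T.countable
  rw [measure_iUnion _ fun w : M => T.measurableSet_event w]
  · simp_rw [T.volume_event]
  · intro w w' hne
    rw [Function.onFun, Set.disjoint_left]
    intro ω hω hω'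
    refine hne (Subtype.ext ?_)
    rcases le_total (T.depth w) (T.depth w') with hd | hd
    · exact h _ w.2 _ w'.2 (T.anc_of_depth_le hω hω' hd)
    · exact (h _ w'.2 _ w.2 (T.anc_of_depth_le hω' hω hd)).symm

/-- The sum of the probabilities of the leaves. -/
noncomputable def leafMass : ENNReal :=
  ∑' v : {v // T.children v = ∅}, ENNReal.ofReal (T.prob v)

/-- Up to the survivors, the leaves partition the event of the root. -/
theorem leafMass_eq_one_of_volume_survivors (h : volume T.survivors = 0) : T.leafMass = 1 := by
  have h1 : volume (T.event T.root) = 1 := by rw [T.volume_event, T.prob_root]; simp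
  have h2 : T.leafMass = volume (⋃ w : {v | T.children v = ∅}, T.event w) := by
    refine T.tsum_eq_volume fun w hw w' _ ha => ?_
    rcases Relation.ReflTransGen.cases_head ha with h | ⟨v, hv, -⟩
    · exact h
    · exact absurd hw (Finset.ne_empty_of_mem hv)
  rw [h2]
  refine le_antisymm ?_ ?_
  · rw [← h1]
    exact measure_mono (Set.iUnion_subset fun w => T.event_mono (T.reachable w))
  · rw [← h1]
    have : T.event T.root ⊆ T.survivors ∪ ⋃ w : {v | T.children v = ∅}, T.event w := by
      intro ω hω
      by_cases hs : ω ∈ T.survivors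
      · exact Or.inl hs
      · right
        simp only [survivors, Set.mem_ofPred_eq, not_and, not_forall, not_not] at hs
        obtain ⟨v, hv, hv'⟩ := hs hω
        exact Set.mem_iUnion.2 ⟨⟨v, hv⟩, hv'⟩
    refine (measure_mono this).trans ((measure_union_le _ _).trans ?_)
    rw [h, zero_add]

/-- If every infinite path has, for one of countably many pairs of a node `v i` and a set `K i` of
marked nodes, the node `v i` and infinitely many nodes of `K i`, and if the tree has infinite
paths with positive probability, then for some `i` the subtree at `v i` can be cut such that all
remaining infinite paths contain infinitely many nodes of `K i`, while infinite paths still have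
positive probability. -/
theorem exists_cut {ι : Type*} [Countable ι] (v : ι → N) (K : ι → Set N)
    (h : ∀ x, x 0 = T.root → T.IsPath x → ∃ i, (∃ n, x n = v i) ∧ {m | x m ∈ K i}.Infinite)
    (hT : T.leafMass ≠ 1) :
    ∃ i, ∃ C : Set N,
      (∀ x, T.IsPath x → (∀ n, x n ∉ C) → {m | x m ∈ K i}.Infinite) ∧
      ∑' w : {w | T.CutReach C (v i) w ∧ (w ∈ C ∨ T.children w = ∅)}, ENNReal.ofReal (T.prob w) <
        ENNReal.ofReal (T.prob (v i)) := by
  have hN := T.countable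
  -- `E i` consists of the survivors whose path visits `v i` and infinitely many nodes of `K i`.
  let E : ι → Set ℝ := fun i => (T.survivors ∩ T.event (v i)) ∩
    ⋂ n : ℕ, ⋃ k : {k // k ∈ K i ∧ n ≤ T.depth k}, T.event k
  have hEm : ∀ i, MeasurableSet (E i) := fun i =>
    (T.measurableSet_survivors.inter (T.measurableSet_event _)).inter
      (MeasurableSet.iInter fun n => MeasurableSet.iUnion fun k => T.measurableSet_event _)
  have hcover : T.survivors ⊆ ⋃ i, E i := by
    intro ω hω
    obtain ⟨x, hx0, hx, hxω⟩ := T.exists_path hω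
    obtain ⟨i, ⟨n, hn⟩, hinf⟩ := h x hx0 hx
    refine Set.mem_iUnion.2 ⟨i, ⟨hω, hn ▸ hxω n⟩, Set.mem_iInter.2 fun l => ?_⟩
    obtain ⟨m, hm, hlm⟩ := hinf.exists_gt l
    refine Set.mem_iUnion.2 ⟨⟨x m, hm, ?_⟩, hxω m⟩
    rw [hx.depth]
    omega
  obtain ⟨i, hi⟩ : ∃ i, volume (E i) ≠ 0 := by
    by_contra hall
    push Not at hall
    exact hT (T.leafMass_eq_one_of_volume_survivors
      (measure_mono_null hcover (measure_iUnion_null hall)))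
  -- `B n d` consists of the points of `E i` without a mark in the depth window `[n, d)`.
  let B : ℕ → ℕ → Set ℝ := fun n d => E i \
    ⋃ k : {k // k ∈ K i ∧ n ≤ T.depth k ∧ T.depth k < d}, T.event k
  have hBm : ∀ n d, MeasurableSet (B n d) := fun n d =>
    (hEm i).diff (MeasurableSet.iUnion fun k => T.measurableSet_event _)
  have hEfin : volume (E i) ≠ ⊤ := by
    refine ne_top_of_le_ne_top ?_ (measure_mono (fun ω hω => hω.1.2 : E i ⊆ T.event (v i)))
    rw [T.volume_event]
    exact ENNReal.ofReal_ne_top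
  have hBsmall : ∀ n, ∀ δ : ENNReal, 0 < δ → ∃ d, n < d ∧ volume (B n d) < δ := by
    intro n δ hδ
    have hanti : Antitone (B n) := by
      intro d d' hdd ω hω
      refine ⟨hω.1, fun hm => hω.2 ?_⟩
      obtain ⟨⟨k, hk, hnk, hkd⟩, hωk⟩ := Set.mem_iUnion.1 hm
      exact Set.mem_iUnion.2 ⟨⟨k, hk, hnk, hkd.trans_le hdd⟩, hωk⟩
    have hempty : ⋂ d, B n d = ∅ := by
      rw [Set.eq_empty_iff_forall_notMem]
      intro ω hω
      have hωE := (Set.mem_iInter.1 hω 0).1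
      obtain ⟨⟨k, hk, hnk⟩, hωk⟩ := Set.mem_iUnion.1 (Set.mem_iInter.1 hωE.2 n)
      exact (Set.mem_iInter.1 hω (T.depth k + 1)).2
        (Set.mem_iUnion.2 ⟨⟨k, hk, hnk, Nat.lt_succ_self _⟩, hωk⟩)
    have hlim := tendsto_measure_iInter_atTop (μ := volume) (s := B n)
      (fun d => (hBm n d).nullMeasurableSet) hanti
      ⟨0, ne_top_of_le_ne_top hEfin (measure_mono Set.sdiff_subset)⟩
    rw [hempty, measure_empty] at hlim
    obtain ⟨d, hd, hnd⟩ := ((hlim.eventually (gt_mem_nhds hδ)).and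
      (Filter.eventually_gt_atTop n)).exists
    exact ⟨d, hnd, hd⟩
  obtain ⟨δ, hδ, hδsum⟩ := ENNReal.exists_pos_sum_of_countable hi ℕ
  choose F hFlt hF using fun (j n : ℕ) => hBsmall n (δ j) (by exact_mod_cast hδ j)
  -- The ends of the windows.
  let d : ℕ → ℕ := fun j => Nat.rec 0 (fun j n => F j n) j
  have hd : ∀ j, d (j + 1) = F j (d j) := fun j => rfl
  have hdlt : ∀ j, d j < d (j + 1) := fun j => by rw [hd]; exact hFlt j (d j)
  have hdmono : StrictMono d := strictMono_nat_of_lt_succ hdlt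
  let G : Set ℝ := E i \ ⋃ j, B (d j) (d (j + 1))
  have hGm : MeasurableSet G := (hEm i).diff (MeasurableSet.iUnion fun j => hBm _ _)
  have hGpos : volume G ≠ 0 := by
    intro h0
    have hsub : E i ⊆ G ∪ ⋃ j, B (d j) (d (j + 1)) := fun ω hω => by
      by_cases hb : ω ∈ ⋃ j, B (d j) (d (j + 1))
      · exact Or.inr hb
      · exact Or.inl ⟨hω, hb⟩
    have h1 : volume (E i) ≤ ∑' j, (δ j : ENNReal) := by
      refine (measure_mono hsub).trans ((measure_union_le _ _).trans ?_)
      rw [h0, zero_add]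
      refine (measure_iUnion_le _).trans (ENNReal.tsum_le_tsum fun j => ?_)
      rw [hd]
      exact (hF j (d j)).le
    exact absurd (h1.trans_lt hδsum) (lt_irrefl _)
  let C : Set N := {w | ∃ j, T.depth w = d (j + 1) ∧
    ∀ k ∈ K i, d j ≤ T.depth k → T.depth k < d (j + 1) → ¬ T.Anc k w}
  refine ⟨i, C, ?_, ?_⟩
  · intro x hx hxC
    rw [Set.infinite_iff_exists_gt]
    intro a
    -- A window below the node `x (a + 1)`.
    let j := T.depth (x 0) + a + 1
    have hj : j ≤ d j := hdmono.id_le j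
    have hj' := hdlt j
    have hdep : T.depth (x (d (j + 1) - T.depth (x 0))) = d (j + 1) := by
      rw [hx.depth]
      omega
    have hnot := hxC (d (j + 1) - T.depth (x 0))
    have : ∃ k ∈ K i, d j ≤ T.depth k ∧ T.depth k < d (j + 1) ∧
        T.Anc k (x (d (j + 1) - T.depth (x 0))) := by
      by_contra hno
      push Not at hno
      exact hnot ⟨j, hdep, hno⟩
    obtain ⟨k, hk, hk1, hk2, hk3⟩ := this
    obtain ⟨m, -, rfl⟩ := hx.eq_of_anc hk3 (by omega)
    refine ⟨m, hk, ?_⟩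
    have := hx.depth m
    omega
  · have hinc : ∀ w ∈ {w | T.CutReach C (v i) w ∧ (w ∈ C ∨ T.children w = ∅)},
        ∀ w' ∈ {w | T.CutReach C (v i) w ∧ (w ∈ C ∨ T.children w = ∅)}, T.Anc w w' → w = w' := by
      intro w hw w' hw' ha
      by_contra hne
      have hin := RootedTree.CutReach.inner hw'.1 ha hw.1.anc.depth_le hne
      rcases hw.2 with hC | hl
      · exact hin.1 hC
      · exact hin.2 hl
    rw [T.tsum_eq_volume hinc, ← T.volume_event]
    have hsub : (⋃ w : {w | T.CutReach C (v i) w ∧ (w ∈ C ∨ T.children w = ∅)}, T.event w) ⊆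
        T.event (v i) \ G := by
      refine Set.iUnion_subset fun w ω hω => ⟨T.event_mono w.2.1.anc hω, fun hG => ?_⟩
      rcases w.2.2 with ⟨j, hj, hk⟩ | hl
      · refine hG.2 (Set.mem_iUnion.2 ⟨j, hG.1, fun hm => ?_⟩)
        obtain ⟨⟨k, hkK, hk1, hk2⟩, hωk⟩ := Set.mem_iUnion.1 hm
        exact hk k hkK hk1 hk2 (T.anc_of_depth_le hωk hω (by omega))
      · exact hG.1.1.1.2 _ hl hω
    have hGsub : G ⊆ T.event (v i) := fun ω hω => hω.1.1.2
    refine (measure_mono hsub).trans_lt ?_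
    have hfin : volume (T.event (v i)) ≠ ⊤ := by
      rw [T.volume_event]
      exact ENNReal.ofReal_ne_top
    rw [measure_sdiff hGsub hGm.nullMeasurableSet (ne_top_of_le_ne_top hfin (measure_mono hGsub))]
    refine ENNReal.sub_lt_self hfin ?_ hGpos
    intro h0
    exact hGpos (measure_mono_null hGsub h0)

end ProbTree

/-! ### Lineages of annotations -/

/-- A variant of König's lemma. Let `Z n` be finite sets such that every element of `Z (n + 1)`
descends, via `R n`, from an element of `Z n`, where only the element `π n` may have several
descendants. If `π n` lies in `Z n` infinitely often, then some infinite line of descendants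
meets `π` infinitely often. -/
theorem exists_lineage {Q : Type*} (R : ℕ → Q → Q → Prop) (Z : ℕ → Set Q)
    (hfin : ∀ n, (Z n).Finite) (hback : ∀ n, ∀ χ' ∈ Z (n + 1), ∃ χ ∈ Z n, R n χ χ') (π : ℕ → Q)
    (hinf : {n | π n ∈ Z n}.Infinite)
    (huniq : ∀ n χ χ₁ χ₂, χ ≠ π n → R n χ χ₁ → R n χ χ₂ → χ₁ = χ₂) :
    ∃ χ : ℕ → Q, (∀ n, χ n ∈ Z n) ∧ (∀ n, R n (χ n) (χ (n + 1))) ∧ {n | χ n = π n}.Infinite := by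
  let Reach : ℕ × Q → ℕ × Q → Prop := Relation.ReflTransGen
    (fun a b => b.1 = a.1 + 1 ∧ R a.1 a.2 b.2 ∧ b.2 ∈ Z b.1)
  -- `Good k χ`: the line `π` meets the descendants of `χ ∈ Z k` infinitely often.
  let Good : ℕ → Q → Prop := fun k χ => {m | Reach (k, χ) (m, π m)}.Infinite
  have hstep : ∀ k χ, Good k χ → ∃ χ', χ' ∈ Z (k + 1) ∧ R k χ χ' ∧ Good (k + 1) χ' := by
    intro k χ hg
    by_contra hno
    push Not at hno
    refine hg (((Set.finite_singleton k).union (((hfin (k + 1)).inter_of_left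
      {χ' | R k χ χ'}).biUnion (t := fun χ' => {m | Reach (k + 1, χ') (m, π m)})
        fun χ' h => ?_)).subset ?_)
    · exact Set.not_infinite.1 (hno χ' h.1 h.2)
    · intro m hm
      rcases Relation.ReflTransGen.cases_head hm with h | ⟨⟨k', χ'⟩, ⟨h1, h2, h3⟩, h4⟩
      · exact Or.inl (congrArg Prod.fst h).symm
      · simp only at h1 h2 h3
        subst h1
        exact Or.inr (Set.mem_biUnion (show χ' ∈ Z (k + 1) ∩ {χ' | R k χ χ'} from ⟨h3, h2⟩) h4)
  have hstart : ∀ m, ∀ χ ∈ Z m, ∃ χ₀ ∈ Z 0, Reach (0, χ₀) (m, χ) := by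
    intro m
    induction m with
    | zero => exact fun χ h => ⟨χ, h, Relation.ReflTransGen.refl⟩
    | succ m ih =>
      intro χ' h
      obtain ⟨χ, hχ, hR⟩ := hback m χ' h
      obtain ⟨χ₀, h₀, hr⟩ := ih χ hχ
      exact ⟨χ₀, h₀, hr.tail ⟨rfl, hR, h⟩⟩
  obtain ⟨χ₀, h₀, hg₀⟩ : ∃ χ₀ ∈ Z 0, Good 0 χ₀ := by
    by_contra hno
    push Not at hno
    refine hinf (((hfin 0).biUnion (t := fun χ => {m | Reach (0, χ) (m, π m)})
      fun χ h => Set.not_infinite.1 (hno χ h)).subset fun m hm => ?_)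
    obtain ⟨χ, hχ, hr⟩ := hstart m _ hm
    exact Set.mem_biUnion hχ hr
  choose f hf hfR hfg using hstep
  let c : ∀ k, {χ // χ ∈ Z k ∧ Good k χ} := fun k =>
    Nat.rec ⟨χ₀, h₀, hg₀⟩ (fun k χ => ⟨f k χ.1 χ.2.2, hf k _ _, hfg k _ _⟩) k
  have hc : ∀ k, (c (k + 1)).1 = f k (c k).1 (c k).2.2 := fun k => rfl
  have hcR : ∀ k, R k (c k).1 (c (k + 1)).1 := fun k => by
    rw [hc]
    exact hfR k _ _
  refine ⟨fun k => (c k).1, fun k => (c k).2.1, hcR, ?_⟩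
  rw [Set.infinite_iff_exists_gt]
  intro k
  by_contra hno
  push Not at hno
  -- Beyond `k`, the chosen line does not branch, so it contains all descendants.
  have hline : ∀ b, Reach (k + 1, (c (k + 1)).1) b → k < b.1 ∧ b.2 = (c b.1).1 := by
    intro b hb
    induction hb with
    | refl => exact ⟨Nat.lt_succ_self k, rfl⟩
    | @tail b b' _ h ih =>
      obtain ⟨m, y⟩ := b
      obtain ⟨m', y'⟩ := b'
      obtain ⟨h1, h2, -⟩ := h
      simp only at h1 h2 ih ⊢
      subst h1
      refine ⟨by omega, ?_⟩
      rw [ih.2] at h2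
      exact huniq m _ _ _ (fun he => absurd (hno m he) (by omega)) h2 (hcR m)
  obtain ⟨m, hm⟩ := (c (k + 1)).2.2.nonempty
  obtain ⟨h1, h2⟩ := hline _ hm
  exact absurd (hno m h2.symm) (not_le.2 h1)

section Lineage

variable {L : Language} {D : ∀ n, Set (L.Functions n)} {V : Type*}

/-- Only the annotation of the redex may have several descendants. -/
theorem StepData.Descends.unique {P : ADPProblem L D V} {a : Prop} {s : ATerm L D V}
    {N : Type*} {S : Finset N} {q : N → ℝ} {t : N → ATerm L D V} {d : StepData P a s S q t} {w : N}
    {χ χ₁ χ₂ : List ℕ} (hne : χ ≠ d.π) (h₁ : d.Descends w χ χ₁) (h₂ : d.Descends w χ χ₂) :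
    χ₁ = χ₂ := by
  rcases h₁ with h₁ | ⟨h, -⟩
  · rcases h₂ with h₂ | ⟨h, -⟩
    · exact h₁.unique h₂
    · exact absurd h hne
  · exact absurd h hne

/-! ### Lineages follow the dependency graph -/

theorem subst_embed (t : L.Term V) (σ : V → L.Term V) :
    (embed (D := D) t).subst (fun x => embed (σ x)) = embed (t.subst σ) := by
  induction t with
  | var x => rfl
  | @func n f ts ih =>
    simp only [embed, anno, Language.Term.subst, Set.mem_empty_iff_false, false_and, dite_false]
    congr 1
    funext i
    exact ih i

theorem replaceAt_sharp {t : L.Term V} {δ : List ℕ} (hδ : δ ≠ []) (v : L.Term V) :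
    replaceAt (sharp (D := D) t) δ (embed v) = sharp (replaceAt t δ v) := by
  have key : ∀ (δ : List ℕ) (t : L.Term V),
      replaceAt (embed (D := D) t) δ (embed v) = embed (replaceAt t δ v) := by
    intro δ
    induction δ with
    | nil => simp
    | cons i δ ih =>
      intro t
      cases t with
      | var x => rfl
      | @func n f ts =>
        simp only [embed, anno, replaceAt_func_cons, Set.mem_empty_iff_false, false_and, dite_false]
        congr 1
        funext j
        split_ifs
        · exact ih _
        · rfl
  cases δ with
  | nil => exact absurd rfl hδ
  | cons i δ =>
    cases t with
    | var x => rfl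
    | @func n f ts =>
      have he : ∀ j : ℕ, {π : List ℕ | j :: π ∈ ({[]} : Set (List ℕ))} = ∅ := by
        intro j
        ext π
        simp
      simp only [sharp, anno, replaceAt_func_cons, he]
      congr 1
      funext j
      split_ifs
      · exact key _ _
      · rfl

/-- A rewrite step below the root of `t` is an `np`-step on `t^#`. -/
theorem npRewrites_sharp {P : ADPProblem L D V} {α : ADP L D V} (hα : α ∈ P)
    (hflag : α.flag = true) {x : ℝ × ATerm L D V} (hx : x ∈ α.rhs) {σ : V → L.Term V}
    (hσ : IsSubst σ) {t : L.Term V} {δ : List ℕ} (hδ : δ ≠ [])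
    (ht : subtermAt t δ = some (α.lhs.subst σ)) :
    npRewrites P (sharp t) (sharp (replaceAt t δ ((flat x.2).subst σ))) := by
  refine ⟨_, ⟨_, ⟨α, hα, hflag, x, hx, rfl⟩, rfl⟩, fun y => embed (σ y), ?_, δ, ?_, ?_⟩
  · refine Set.Finite.subset hσ fun y hy h => hy ?_
    have h' : embed (D := D) (σ y) = embed (.var y) := by rw [h]
    exact h'
  · have he : {χ | δ ++ χ ∈ ({[]} : Set (List ℕ))} = ∅ := by
      ext χ
      simp [hδ]
    rw [subst_embed, sharp, subtermAt_anno, ht, he]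
    rfl
  · rw [subst_embed, replaceAt_sharp hδ]

/-- The subterm at a kept annotation is not affected by the step, or is rewritten with `np(P)`
below its root. -/
theorem StepData.reflTransGen_of_kept {P : ADPProblem L D V} {a : Prop} {s : ATerm L D V}
    {N : Type*} {S : Finset N} {q : N → ℝ} {t : N → ATerm L D V} (d : StepData P a s S q t) {w : N}
    (hw : w ∈ S) {χ χ' : List ℕ} (h : Kept d.rule.flag d.rule.lhs d.π (d.φ w) χ χ')
    {v : L.Term V} (hv : subtermAt (flat s) χ = some v) :
    ∃ v', subtermAt (flat (t w)) χ' = some v' ∧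
      Relation.ReflTransGen (npRewrites P) (sharp v) (sharp v') := by
  have hu : subtermAt (flat s) d.π = some (d.rule.lhs.subst d.σ) := by
    rw [subtermAt_flat, d.subterm_eq, ← d.flat_eq]
    rfl
  rw [d.term_eq w hw, flat_contract]
  rcases h with ⟨rfl, h1, h2⟩ | ⟨ρ, hρ, ρ', τ, hφ, rfl, rfl⟩
  · by_cases hp : χ' <+: d.π
    · obtain ⟨δ, hδ⟩ := hp
      have hδ0 : δ ≠ [] := by
        rintro rfl
        rw [List.append_nil] at hδ
        exact h1 (by rw [hδ])
      have hflag : d.rule.flag = true := by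
        by_contra hf
        exact h2 (by simpa using hf) ⟨δ, hδ⟩
      have hx : (q w, d.r w) ∈ d.rule.rhs := by
        rw [d.rhs_eq]
        exact Multiset.mem_map.2 ⟨w, hw, rfl⟩
      rw [← hδ, subtermAt_append_of_eq_some hv] at hu
      refine ⟨_, by rw [← hδ]; exact subtermAt_replaceAt_above hv _ δ, ?_⟩
      exact Relation.ReflTransGen.single
        (npRewrites_sharp d.rule_mem hflag hx d.isSubst hδ0 hu)
    · exact ⟨v, by rw [subtermAt_replaceAt_of_incomparable _ _ h1 hp, hv],
        Relation.ReflTransGen.refl⟩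
  · refine ⟨v, ?_, Relation.ReflTransGen.refl⟩
    rw [subtermAt_replaceAt_append hu, (d.vrf w hw).subtermAt_subst hρ hφ,
      ← subtermAt_append_of_eq_some hu, hv]

/-- If an annotation created by the `k`-th step of a path is next used by the `k'`-th step, then
the dependency graph has an edge between the ADPs of the two steps. -/
theorem edge_of_lineage {P : ADPProblem L D V} {N : Type*} {S : ℕ → Finset N} {q : ℕ → N → ℝ}
    {t : N → ATerm L D V} {a : ℕ → Prop} {x : ℕ → N}
    (d : ∀ n, StepData P (a n) (t (x n)) (S n) (q n) t) (hx : ∀ n, x (n + 1) ∈ S n)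
    {χ : ℕ → List ℕ} (hχ : ∀ n, (d n).Descends (x (n + 1)) (χ n) (χ (n + 1))) {k k' : ℕ}
    (hkk' : k < k') (hk : χ k = (d k).π) (hk' : χ k' = (d k').π)
    (hbetween : ∀ m, k < m → m < k' → χ m ≠ (d m).π) :
    Edge P (d k).rule (d k').rule := by
  obtain ⟨τ, hτ, hχτ⟩ : ∃ τ ∈ annPos ((d k).r (x (k + 1))), χ (k + 1) = (d k).π ++ τ := by
    rcases hχ k with h | h
    · exact absurd hk (h.ne_redex (d k).rule.lhs_root)
    · exact h.2
  obtain ⟨w, hw, -⟩ := exists_defRoot_of_mem_annPos hτ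
  have hredex : ∀ n, subtermAt (flat (t (x n))) (d n).π =
      some ((d n).rule.lhs.subst (d n).σ) := by
    intro n
    rw [subtermAt_flat, (d n).subterm_eq, ← (d n).flat_eq]
    rfl
  have key : ∀ m, k + 1 ≤ m → m ≤ k' → ∃ v, subtermAt (flat (t (x m))) (χ m) = some v ∧
      Relation.ReflTransGen (npRewrites P) (sharp (w.subst (d k).σ)) (sharp v) := by
    intro m hm
    induction m, hm using Nat.le_induction with
    | base =>
      intro _
      refine ⟨_, ?_, Relation.ReflTransGen.refl⟩
      rw [hχτ, (d k).term_eq _ (hx k), flat_contract, subtermAt_replaceAt_append (hredex k)]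
      exact subtermAt_subst hw _
    | succ m hm ih =>
      intro hmk'
      obtain ⟨v, hv, hr⟩ := ih (by omega)
      rcases hχ m with h | h
      · obtain ⟨v', hv', hr'⟩ := (d m).reflTransGen_of_kept (hx m) h hv
        exact ⟨v', hv', hr.trans hr'⟩
      · exact absurd h.1 (hbetween m (by omega) (by omega))
  obtain ⟨v, hv, hr⟩ := key k' hkk' le_rfl
  rw [hk', hredex k'] at hv
  obtain rfl := Option.some.inj hv
  obtain ⟨u, hu, rfl⟩ := subtermAt_flat_eq_some hw
  refine ⟨(d k).σ, (d k').σ, (d k).isSubst, (d k').isSubst, (q k (x (k + 1)), (d k).r (x (k + 1))),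
    ?_, flat u, ⟨τ, hτ, u, hu, rfl⟩, hr⟩
  rw [(d k).rhs_eq]
  exact Multiset.mem_map.2 ⟨_, hx k, rfl⟩

/-- An infinite path of the dependency graph eventually stays in an SCC. -/
theorem exists_isSCC_of_path {P : ADPProblem L D V} {y : ℕ → ADP L D V} (hy : ∀ i, y i ∈ P)
    (hE : ∀ i, Edge P (y i) (y (i + 1))) : ∃ X, IsSCC P X ∧ ∃ i₀, ∀ i, i₀ ≤ i → y i ∈ X := by
  classical
  let Y : ADPProblem L D V := P.filter fun α => {i | y i = α}.Infinite
  obtain ⟨i₀, hi₀⟩ : ∃ i₀, ∀ i, i₀ ≤ i → y i ∈ Y := by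
    have hfin : (⋃ α ∈ P \ Y, {i | y i = α}).Finite := by
      refine Set.Finite.biUnion (P \ Y).finite_toSet fun α hα => ?_
      rw [Finset.coe_sdiff] at hα
      by_contra hinf
      exact hα.2 (Finset.mem_coe.2 (Finset.mem_filter.2 ⟨hα.1, hinf⟩))
    obtain ⟨b, hb⟩ := hfin.bddAbove
    refine ⟨b + 1, fun i hi => ?_⟩
    by_contra hiY
    have : i ≤ b := hb (Set.mem_biUnion (Finset.mem_sdiff.2 ⟨hy i, hiY⟩) rfl)
    omega
  have hpath : ∀ i j, i₀ ≤ i → i < j →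
      Relation.TransGen (fun γ δ => γ ∈ Y ∧ δ ∈ Y ∧ Edge P γ δ) (y i) (y j) := by
    intro i j hi hij
    induction j, hij using Nat.le_induction with
    | base => exact .single ⟨hi₀ _ hi, hi₀ _ (by omega), hE i⟩
    | succ j hj ih => exact ih.tail ⟨hi₀ _ (by omega), hi₀ _ (by omega), hE j⟩
  have hcycle : IsCycle P Y := by
    refine ⟨Finset.filter_subset _ _, ⟨_, hi₀ i₀ le_rfl⟩, fun α hα β hβ => ?_⟩
    obtain ⟨i, rfl, hi⟩ := (Finset.mem_filter.1 hα).2.exists_gt i₀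
    obtain ⟨j, rfl, hj⟩ := (Finset.mem_filter.1 hβ).2.exists_gt i
    exact hpath i j hi.le hj
  have hfin : {X | IsCycle P X}.Finite :=
    P.powerset.finite_toSet.subset fun X hX => Finset.mem_coe.2 (Finset.mem_powerset.2 hX.1)
  obtain ⟨X, hYX, hX⟩ := hfin.exists_le_maximal hcycle
  exact ⟨X, hX, i₀, fun i hi => hYX (hi₀ i hi)⟩

/-- On a path with infinitely many annotated steps, some infinite lineage of annotations is used
infinitely often, and from some point on only by ADPs of a single SCC. -/
theorem exists_lineage_in_scc {P : ADPProblem L D V} {N : Type*} {S : ℕ → Finset N}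
    {q : ℕ → N → ℝ} {t : N → ATerm L D V} {a : ℕ → Prop} {x : ℕ → N}
    (d : ∀ n, StepData P (a n) (t (x n)) (S n) (q n) t) (hx : ∀ n, x (n + 1) ∈ S n)
    (ha : {n | a n}.Infinite) :
    ∃ X, IsSCC P X ∧ ∃ (χ : ℕ → List ℕ) (n₀ : ℕ), (∀ n, χ n ∈ annPos (t (x n))) ∧
      (∀ n, (d n).Descends (x (n + 1)) (χ n) (χ (n + 1))) ∧ {n | χ n = (d n).π}.Infinite ∧
      ∀ n, n₀ ≤ n → χ n = (d n).π → (d n).rule ∈ X := by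
  classical
  obtain ⟨χ, hχ, hdesc, hinf⟩ := exists_lineage
    (fun n => (d n).Descends (x (n + 1))) (fun n => annPos (t (x n)))
    (fun n => finite_annPos _) (fun n χ' h => ((d n).mem_annPos_iff (hx n) χ').1 h)
    (fun n => (d n).π) (by simpa only [← (d _).ann_iff] using ha)
    (fun n χ χ₁ χ₂ hne h₁ h₂ => h₁.unique hne h₂)
  -- The ADPs that use the lineage form an infinite path of the dependency graph.
  let ν : ℕ → ℕ := Nat.nth fun n => χ n = (d n).π
  have hν : ∀ i, χ (ν i) = (d (ν i)).π := fun i => Nat.nth_mem_of_infinite hinf i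
  obtain ⟨X, hX, i₀, hi₀⟩ := exists_isSCC_of_path (P := P) (y := fun i => (d (ν i)).rule)
    (fun i => (d _).rule_mem) (fun i => edge_of_lineage d hx hdesc
      (Nat.nth_strictMono hinf (Nat.lt_succ_self i)) (hν i) (hν (i + 1)) (fun m h₁ h₂ hm => by
        have h' := Nat.nth_count (p := fun n => χ n = (d n).π) hm
        have h₃ : i < Nat.count (fun n => χ n = (d n).π) m := by
          rw [← (Nat.nth_strictMono hinf).lt_iff_lt, h']
          exact h₁
        have h₄ : Nat.count (fun n => χ n = (d n).π) m < i + 1 := by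
          rw [← (Nat.nth_strictMono hinf).lt_iff_lt, h']
          exact h₂
        omega))
  refine ⟨X, hX, χ, ν i₀, hχ, hdesc, hinf, fun n hn hn' => ?_⟩
  have h' := Nat.nth_count (p := fun n => χ n = (d n).π) hn'
  have h₃ : i₀ ≤ Nat.count (fun n => χ n = (d n).π) n := by
    rw [← (Nat.nth_strictMono hinf).le_iff_le, h']
    exact hn
  have := hi₀ _ h₃
  rwa [show ν (Nat.count (fun n => χ n = (d n).π) n) = n from h'] at this

end Lineage

/-! ### Relabelling chain trees -/

section ChainTrees

variable {L : Language} {D : ∀ n, Set (L.Functions n)} {V : Type*}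

/-- The data of the rewrite step at an inner node of a chain tree. -/
noncomputable def ChainTree.stepData {P : ADPProblem L D V} (T : ChainTree P) (v : T.Node)
    (hv : (T.children v).Nonempty) : StepData P (v ∈ T.A) (T.term v) (T.children v)
      (fun w => T.prob w / T.prob v) T.term :=
  (T.step v hv).exists_stepData.some

/-- The tree of a chain tree, without its terms. -/
def ChainTree.toProbTree {P : ADPProblem L D V} (T : ChainTree P) : ProbTree T.Node where
  root := T.root
  children := T.children
  root_not_child := T.root_not_child
  parent_unique := T.parent_unique
  reachable := T.reachable
  prob := T.prob
  prob_pos := T.prob_pos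
  prob_root := T.prob_root
  sum_children v hv := by
    have h := (T.stepData v hv).rule.rhs_dist.2
    rw [(T.stepData v hv).rhs_eq, Multiset.map_map] at h
    have h' : ∑ w ∈ T.children v, T.prob w / T.prob v = 1 := h
    rwa [← Finset.sum_div, div_eq_one_iff_eq (T.prob_pos v).ne'] at h'

/-- The terms of a chain tree can be relabelled from the node `v₀` on: the tree becomes a tree
of steps with counterparts of the ADPs, where the annotations of the term at `v₀` and
those created by the ADPs in `keep` are propagated. -/
theorem ChainTree.exists_relabel {P Q : ADPProblem L D V} {keep : Set (ADP L D V)}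
    (hPQ : Refines keep P Q) (T : ChainTree P) (v₀ : T.Node) :
    ∃ s : T.Node → ATerm L D V, s v₀ = T.term v₀ ∧
      ∀ v (hv : (T.children v).Nonempty), v₀ ∉ T.children v →
        Step Q ((T.stepData v hv).π ∈ annPos (s v)) (s v)
          ((T.children v).val.map (fun w => (T.prob w / T.prob v, s w))) ∧
        ∀ w ∈ T.children v, ∀ χ ∈ annPos (s v), ∀ χ', (T.stepData v hv).Descends w χ χ' →
          (χ = (T.stepData v hv).π → (T.stepData v hv).rule ∈ keep) → χ' ∈ annPos (s w) := by
  classical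
  have hex : ∀ v (s : ATerm L D V), ∃ t' : T.Node → ATerm L D V,
      ∀ hv : (T.children v).Nonempty, flat s = flat (T.term v) →
        Step Q ((T.stepData v hv).π ∈ annPos s) s
          ((T.children v).val.map (fun w => (T.prob w / T.prob v, t' w))) ∧
        ∀ w ∈ T.children v, flat (t' w) = flat (T.term w) ∧
          ∀ χ ∈ annPos s, ∀ χ', (T.stepData v hv).Descends w χ χ' →
            (χ = (T.stepData v hv).π → (T.stepData v hv).rule ∈ keep) → χ' ∈ annPos (t' w) := by
    intro v s
    by_cases h : (T.children v).Nonempty ∧ flat s = flat (T.term v)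
    · obtain ⟨t', ht'⟩ := (T.stepData v h.1).exists_retarget hPQ h.2
      exact ⟨t', fun _ _ => ht'⟩
    · exact ⟨T.term, fun hv hs => absurd ⟨hv, hs⟩ h⟩
  choose F hF using hex
  obtain ⟨s, hs0, hs⟩ := T.toProbTree.exists_recursion (T.term T.root)
    (fun v w y => if w = v₀ then T.term v₀ else F v y w)
  have hs' : ∀ v, ∀ w ∈ T.children v, s w = if w = v₀ then T.term v₀ else F v (s v) w := hs
  have hflat : ∀ v, flat (s v) = flat (T.term v) := by
    intro v
    induction T.reachable v with
    | refl => exact congrArg flat hs0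
    | @tail v w _ hw ih =>
      rw [hs' v w hw]
      split_ifs with h
      · rw [h]
      · exact ((hF v (s v) ⟨w, hw⟩ ih).2 w hw).1
  refine ⟨s, ?_, fun v hv hv₀ => ?_⟩
  · rcases T.toProbTree.eq_root_or_exists_parent v₀ with h | ⟨v, hv⟩
    · rw [h]
      exact hs0
    · rw [hs' v v₀ hv, if_pos rfl]
  · have hsw : ∀ w ∈ T.children v, s w = F v (s v) w := by
      intro w hw
      rw [hs' v w hw, if_neg]
      rintro rfl
      exact hv₀ hw
    obtain ⟨h1, h2⟩ := hF v (s v) hv (hflat v)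
    refine ⟨?_, fun w hw χ hχ χ' h hk => ?_⟩
    · rw [Multiset.map_congr rfl fun w hw => by rw [hsw w hw] ]
      exact h1
    · rw [hsw w hw]
      exact (h2 w hw).2 χ hχ χ' h hk

/-- A tree of rewrite steps below `v₀` that is cut at the nodes of `C` refutes almost-sure
termination if its infinite paths have infinitely many annotated steps and the nodes where it
ends do not have the full probability of `v₀`. -/
theorem not_isAST_of_cut {Q : ADPProblem L D V} {N : Type} (T : ProbTree N) (v₀ : N) (C : Set N)
    (s : N → ATerm L D V) (A : Set N) (hA : ∀ v ∈ A, (T.children v).Nonempty)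
    (hstep : ∀ v, T.Anc v₀ v → (T.children v).Nonempty → Step Q (v ∈ A) (s v)
      ((T.children v).val.map (fun w => (T.prob w / T.prob v, s w))))
    (hinf : ∀ x, T.IsPath x → (∀ n, x n ∉ C) → {m | x m ∈ A}.Infinite)
    (hmass : ∑' w : {w | T.CutReach C v₀ w ∧ (w ∈ C ∨ T.children w = ∅)},
      ENNReal.ofReal (T.prob w) < ENNReal.ofReal (T.prob v₀)) : ¬ IsAST Q := by
  classical
  let ch : {w // T.CutReach C v₀ w} → Finset {w // T.CutReach C v₀ w} := fun v =>
    if v.1 ∈ C then ∅ else (T.children v.1).subtype _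
  have hch : ∀ v w, w ∈ ch v ↔ v.1 ∉ C ∧ w.1 ∈ T.children v.1 := by
    intro v w
    by_cases h : v.1 ∈ C <;> simp [ch, h]
  have hch_map : ∀ v, v.1 ∉ C → (ch v).val.map Subtype.val = (T.children v.1).val := by
    intro v h
    have h1 : ch v = (T.children v.1).subtype _ := if_neg h
    have h2 := Finset.subtype_map_of_mem (s := T.children v.1) (p := fun w => T.CutReach C v₀ w)
      (fun w hw => Relation.ReflTransGen.tail v.2 ⟨h, hw⟩)
    rw [h1]
    exact congrArg Finset.val h2
  have hne : ∀ v, (ch v).Nonempty → v.1 ∉ C ∧ (T.children v.1).Nonempty := fun v ⟨w, hw⟩ =>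
    ⟨((hch v w).1 hw).1, w.1, ((hch v w).1 hw).2⟩
  have hempty : ∀ v, ch v = ∅ ↔ v.1 ∈ C ∨ T.children v.1 = ∅ := by
    intro v
    constructor
    · intro h
      by_contra hno
      push Not at hno
      obtain ⟨w, hw⟩ := hno.2
      have : (⟨w, Relation.ReflTransGen.tail v.2 ⟨hno.1, hw⟩⟩ : {w // T.CutReach C v₀ w}) ∈ ch v :=
        (hch _ _).2 ⟨hno.1, hw⟩
      rw [h] at this
      simp at this
    · intro h
      rw [Finset.eq_empty_iff_forall_notMem]
      intro w hw
      obtain ⟨h1, h2⟩ := (hch v w).1 hw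
      rcases h with h | h
      · exact h1 h
      · rw [h] at h2
        simp at h2
  let T' : ChainTree Q :=
    { Node := {w // T.CutReach C v₀ w}
      root := ⟨v₀, Relation.ReflTransGen.refl⟩
      children := ch
      root_not_child := fun v hv => by
        have h1 := T.depth_of_mem ((hch _ _).1 hv).2
        have h2 := v.2.anc.depth_le
        simp only at h1
        omega
      parent_unique := fun v v' w h h' => Subtype.ext
        (T.parent_unique _ _ _ ((hch _ _).1 h).2 ((hch _ _).1 h').2)
      reachable := by
        rintro ⟨w, hw⟩
        induction hw with
        | refl => exact Relation.ReflTransGen.refl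
        | tail hv h ih => exact ih.tail ((hch _ _).2 h)
      prob := fun w => T.prob w.1 / T.prob v₀
      term := fun w => s w.1
      prob_pos := fun w => div_pos (T.prob_pos _) (T.prob_pos _)
      prob_le_one := fun w => (div_le_one (T.prob_pos _)).2 (T.prob_le_of_anc w.2.anc)
      prob_root := div_self (T.prob_pos _).ne'
      A := {w | w.1 ∈ A ∧ w.1 ∉ C}
      inner_of_mem_A := fun v hv => by
        obtain ⟨w, hw⟩ := hA _ hv.1
        exact ⟨⟨w, Relation.ReflTransGen.tail v.2 ⟨hv.2, hw⟩⟩, (hch _ _).2 ⟨hv.2, hw⟩⟩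
      step := fun v hv => by
        obtain ⟨h1, h2⟩ := hne v hv
        have h := hstep v.1 v.2.anc h2
        rw [← hch_map v h1, Multiset.map_map] at h
        have ha : (v ∈ {w : {w // T.CutReach C v₀ w} | w.1 ∈ A ∧ w.1 ∉ C}) = (v.1 ∈ A) :=
          propext ⟨fun h => h.1, fun h => ⟨h, h1⟩⟩
        rw [ha]
        convert h using 3 with w
        · exact div_div_div_cancel_right₀ (T.prob_pos v₀).ne' _ _
        · rfl
      infinite_path := fun x hx => by
        have hC : ∀ n, (x n).1 ∉ C := fun n => ((hch _ _).1 (hx n)).1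
        refine (hinf (fun n => (x n).1) (fun n => ((hch _ _).1 (hx n)).2) hC).mono ?_
        exact fun n hn => ⟨hn, hC n⟩ }
  intro hAST
  have h1 : T'.leafMass = 1 := hAST T'
  let e : {v : {w // T.CutReach C v₀ w} // ch v = ∅} ≃
      {w | T.CutReach C v₀ w ∧ (w ∈ C ∨ T.children w = ∅)} :=
    { toFun := fun v => ⟨v.1.1, v.1.2, (hempty _).1 v.2⟩
      invFun := fun w => ⟨⟨w.1, w.2.1⟩, (hempty _).2 w.2.2⟩
      left_inv := fun _ => rfl
      right_inv := fun _ => rfl }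
  have h2 : T'.leafMass * ENNReal.ofReal (T.prob v₀) =
      ∑' w : {w | T.CutReach C v₀ w ∧ (w ∈ C ∨ T.children w = ∅)}, ENNReal.ofReal (T.prob w) := by
    rw [← e.tsum_eq, ChainTree.leafMass, ← ENNReal.tsum_mul_right]
    refine tsum_congr fun v => ?_
    rw [← ENNReal.ofReal_mul (div_pos (T.prob_pos _) (T.prob_pos _)).le]
    exact congrArg ENNReal.ofReal (div_mul_cancel₀ _ (T.prob_pos v₀).ne')
  rw [h1, one_mul] at h2
  exact absurd h2.symm hmass.ne

/-! ### Soundness and completeness -/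

@[simp] theorem annPos_embed (t : L.Term V) : annPos (embed (D := D) t) = ∅ := by
  ext π
  simp [embed, mem_annPos_anno_iff]

/-- In the problem for an SCC `X`, only the ADPs of `X` keep their annotations. -/
theorem refines_union_flatProblem (P X : ADPProblem L D V) :
    Refines (X : Set (ADP L D V)) P (X ∪ flatProblem (P \ X)) := by
  intro α hα
  by_cases hX : α ∈ X
  · exact ⟨α, Finset.mem_union_left _ hX, rfl, rfl,
      Multiset.rel_refl_of_refl_on fun x _ => ⟨rfl, rfl, fun _ => subset_rfl⟩⟩
  · refine ⟨α.flat, Finset.mem_union_right _ (Finset.mem_image_of_mem _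
      (Finset.mem_sdiff.2 ⟨hα, hX⟩)), rfl, rfl, ?_⟩
    refine Multiset.rel_map_right.2 (Multiset.rel_refl_of_refl_on fun x _ => ⟨rfl, ?_, ?_⟩)
    · simp [embed]
    · exact fun h => absurd h hX

theorem union_flatProblem_refines {P X : ADPProblem L D V} (hX : X ⊆ P) :
    Refines Set.univ (X ∪ flatProblem (P \ X)) P := by
  intro β hβ
  rcases Finset.mem_union.1 hβ with h | h
  · exact ⟨β, hX h, rfl, rfl,
      Multiset.rel_refl_of_refl_on fun x _ => ⟨rfl, rfl, fun _ => subset_rfl⟩⟩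
  · obtain ⟨α, hα, rfl⟩ := Finset.mem_image.1 h
    refine ⟨α, (Finset.mem_sdiff.1 hα).1, rfl, rfl, ?_⟩
    refine Multiset.rel_map_left.2 (Multiset.rel_refl_of_refl_on fun x _ => ⟨rfl, ?_, ?_⟩)
    · simp [embed]
    · simp

/-- If the dependency graph processor yields only almost-surely terminating problems, then the
problem terminates almost surely: otherwise, for some SCC `X` and some node `v` of a
counterexample, the infinite paths below `v` on which the relabelling for `X` has infinitely many
annotated steps have positive probability, and cutting the tree yields a counterexample for `X`. -/
theorem isAST_of_forall_isSCC {P : ADPProblem L D V}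
    (h : ∀ X, IsSCC P X → IsAST (X ∪ flatProblem (P \ X))) : IsAST P := by
  classical
  intro T
  by_contra hT
  choose s hs₀ hs using fun i : {X // IsSCC P X} × T.Node =>
    T.exists_relabel (refines_union_flatProblem P i.1.1) i.2
  -- The nodes with an annotated step in the relabelling for the SCC `i.1` from the node `i.2` on.
  let A : {X // IsSCC P X} × T.Node → Set T.Node := fun i =>
    {v | ∃ hv : (T.children v).Nonempty, (T.stepData v hv).π ∈ annPos (s i v)}
  have hfin : {X | IsSCC P X}.Finite :=
    P.powerset.finite_toSet.subset fun X hX =>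
      Finset.mem_coe.2 (Finset.mem_powerset.2 hX.prop.1)
  have : Countable {X // IsSCC P X} := hfin.countable.to_subtype
  have : Countable T.Node := T.toProbTree.countable
  have hbelow : ∀ v₀ v, T.toProbTree.Anc v₀ v → v₀ ∉ T.children v := by
    intro v₀ v hv hmem
    have h1 := T.toProbTree.depth_of_mem hmem
    have h2 := hv.depth_le
    omega
  obtain ⟨i, C, hC, hmass⟩ := T.toProbTree.exists_cut (fun i : {X // IsSCC P X} × T.Node => i.2) A
    (fun x _ hx => by
      obtain ⟨X, hX, χ, n₀, hχ, hdesc, hinf, hrule⟩ := exists_lineage_in_scc (x := x)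
        (fun n => T.stepData (x n) ⟨x (n + 1), hx n⟩) hx (T.infinite_path x hx)
      refine ⟨(⟨X, hX⟩, x n₀), ⟨n₀, rfl⟩, ?_⟩
      have hanc : ∀ n, n₀ ≤ n → T.toProbTree.Anc (x n₀) (x n) := by
        intro n hn
        induction n, hn using Nat.le_induction with
        | base => exact Relation.ReflTransGen.refl
        | succ n _ ih => exact ih.tail (hx n)
      -- The lineage stays annotated in the terms that are relabelled from `x n₀` on.
      have hmem : ∀ n, n₀ ≤ n → χ n ∈ annPos (s (⟨X, hX⟩, x n₀) (x n)) := by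
        intro n hn
        induction n, hn using Nat.le_induction with
        | base =>
          rw [hs₀ (⟨X, hX⟩, x n₀)]
          exact hχ n₀
        | succ n hn ih =>
          exact (hs (⟨X, hX⟩, x n₀) (x n) ⟨_, hx n⟩ (hbelow _ _ (hanc n hn))).2 _ (hx n) _ ih _
            (hdesc n) (hrule n hn)
      refine (hinf.sdiff (Set.finite_lt_nat n₀)).mono fun n hn => ?_
      refine ⟨⟨_, hx n⟩, ?_⟩
      have h1 := hmem n (not_lt.1 hn.2)
      rwa [show χ n = _ from hn.1] at h1) hT
  refine not_isAST_of_cut T.toProbTree i.2 C (s i) (A i) (fun v hv => hv.1) (fun v hv hne => ?_)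
    hC hmass (h i.1.1 i.1.2)
  have hA : (v ∈ A i) = ((T.stepData v hne).π ∈ annPos (s i v)) :=
    propext ⟨fun h => h.2, fun h => ⟨hne, h⟩⟩
  rw [hA]
  exact (hs i v hne (hbelow _ _ hv)).1

/-- Almost-sure termination is inherited by problems with fewer annotations: the relabelled tree
has the same nodes and probabilities, and more annotated steps. -/
theorem IsAST.of_refines {P Q : ADPProblem L D V} (hQP : Refines Set.univ Q P) (h : IsAST P) :
    IsAST Q := by
  intro T
  obtain ⟨s, hs₀, hs⟩ := T.exists_relabel hQP T.root
  have hsub : ∀ v, annPos (T.term v) ⊆ annPos (s v) := by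
    intro v
    induction T.reachable v with
    | refl => rw [hs₀]
    | @tail v w _ hw ih =>
      intro χ' hχ'
      obtain ⟨χ, hχ, hd⟩ := ((T.stepData v ⟨w, hw⟩).mem_annPos_iff hw χ').1 hχ'
      exact (hs v ⟨w, hw⟩ (T.root_not_child v)).2 w hw χ (ih hχ) χ' hd fun _ => trivial
  let A : Set T.Node :=
    {v | ∃ hv : (T.children v).Nonempty, (T.stepData v hv).π ∈ annPos (s v)}
  exact h
    { T with
      term := s
      A := A
      inner_of_mem_A := fun v hv => hv.1
      step := fun v hv => by
        have hA : (v ∈ A) = ((T.stepData v hv).π ∈ annPos (s v)) :=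
          propext ⟨fun h => h.2, fun h => ⟨hv, h⟩⟩
        rw [hA]
        exact (hs v hv (T.root_not_child v)).1
      infinite_path := fun x hx => (T.infinite_path x hx).mono fun n hn =>
        ⟨⟨_, hx n⟩, hsub _ ((T.stepData (x n) ⟨_, hx n⟩).ann_iff.1 hn)⟩ }

end ChainTrees

end ProbADP

theorem mainTheorem4 (L : FirstOrder.Language) (D : ∀ n, Set (L.Functions n)) (V : Type*) :
    (ProbADP.depGraphProcessor L D V).Sound ∧ (ProbADP.depGraphProcessor L D V).Complete := by
  classical
  constructor
  · intro P h
    refine ProbADP.isAST_of_forall_isSCC fun X hX => h _ ?_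
    exact Finset.mem_image.2
      ⟨X, Finset.mem_filter.2 ⟨Finset.mem_powerset.2 hX.prop.1, hX⟩, by congr⟩
  · intro P h Q hQ
    obtain ⟨X, hX, rfl⟩ := Finset.mem_image.1 hQ
    have hsub := Finset.mem_powerset.1 (Finset.mem_filter.1 hX).1
    refine ProbADP.IsAST.of_refines ?_ h
    convert ProbADP.union_flatProblem_refines hsub
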